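/- Let $\mathbb{H}^3=\{(x,y,z)\in\mathbb{R}^3 : z>0\}$ carry the hyperbolic metric $(dx^2+dy^2+dz^2)/z^2$. For $h>0$ let $\mathscr H_h=\{z=h\}$ be the horosphere at height $h$, and $\mathscr H=\mathscr H_1$. A translator is a surface $\Sigma\subset\mathbb{H}^3$ such that the family $\Gamma_t(\Sigma)$, $\Gamma_t(p)=e^tp$, $t\in\mathbb{R}$, evolves under mean curvature flow in $\mathbb{H}^3$, that is, at each time and at each point the normal component of its velocity equals the mean curvature vector $H\eta$, where $H=(k_1+k_2)/2$. There exists a one-parameter family $\{\Sigma_r \mid r>0\}$ of pairwise noncongruent (no isometry of $\mathbb{H}^3$ takes $\Sigma_r$ onto $\Sigma_{r'}$ if $r\ne r'$), properly embedded annular translators in $\mathbb{H}^3$, each invariant under all rotations about the $z$-axis, with the following properties for every $r>0$. (i) There are numbers $0<r^-<1<r^+$ such that $\Sigma_r$ is contained in the slab $\{r^-<z<r^+\}$ determined by the horospheres $\mathscr H_{r^-}$ and $\mathscr H_{r^+}$. The asymptotic boundary of $\Sigma_r$ is the single point $\infty$, which is also that of $\mathscr H$. (ii) $\Sigma_r$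 is the union of the vertical graphs $z=u_r^-(x,y)$ and $z=u_r^+(x,y)$ of two functions on $\{x^2+y^2\ge r^2\}$, the complement of the open Euclidean $r$-disk centered at the rotation axis in $\mathscr H$. These functions are continuous there and $C^\infty$ on $\{x^2+y^2>r^2\}$. (iii) The graphs $\Sigma_r^-$ and $\Sigma_r^+$ of $u_r^-$ and $u_r^+$ over $\{x^2+y^2>r^2\}$ lie in distinct connected components of $\mathbb{H}^3\setminus\mathscr H$, namely in $\{0<z<1\}$ and $\{z>1\}$ respectively. Their common boundary is the circle $\{x^2+y^2=r^2,\ z=1\}$, and $\Sigma_r^\pm$ is asymptotic to $\mathscr H_{r^\pm}$, that is, $u_r^\pm(x,y)\to r^\pm$ as $|(x,y)|\to\infty$. In addition, $r^+\to1$ and $r^-\to1$ both as $r\to0$ and as $r\to\infty$, and: (iv) As $r\to0$, $\Sigma_r$ converges in $C^{2,\alpha}$, for every $\alpha\in(0,1)$, to a double copy of $\mathscr H$ on compact sets that do not contain $(0,0,1)$. Precisely, for each compact $C\subset\mathbb{R}^2\setminus\{(0,0)\}$ the $C^{2,\alpha}$ norms on $C$ of $u_r^--1$ and of $u_r^+-1$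 tend to $0$; and for each compact $K\subset\mathbb{H}^3\setminus\{(0,0,1)\}$ there is a compact $C\subset\mathbb{R}^2\setminus\{(0,0)\}$ such that, for all sufficiently small $r>0$, $\Sigma_r\cap K$ is contained in the union of the graphs of $u_r^-$ and $u_r^+$ over $C$. (v) As $r\to\infty$, $\Sigma_r$ escapes to infinity: for each compact $K\subset\mathbb{H}^3$, $\Sigma_r\cap K=\emptyset$ for all sufficiently large $r$. -/

import Mathlib

open Set Filter Topology
open scoped ContDiff ENNReal

noncomputable section

namespace HypTranslator

/-! Hyperbolic 3-space: the upper half-space with the metric `(dx² + dy² + dz²) / z²`. -/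

/-- Coordinates `(x, y, z) = (p 0, p 1, p 2)` of `ℝ³`. -/
abbrev E3 := Fin 3 → ℝ

/-- The open upper half-space, carrier of hyperbolic space. -/
def H3 : Set E3 := {p | 0 < p 2}

/-- The hyperbolic metric tensor at `p`, applied to `v` and `w`. -/
def hypMetric (p v w : E3) : ℝ := (∑ i, v i * w i) / p 2 ^ 2

/-- The coefficients `g_ij` of the hyperbolic metric in the coordinates `(x, y, z)`. -/
def hypGram (p : E3) : Matrix (Fin 3) (Fin 3) ℝ :=
  Matrix.of fun i j => hypMetric p (Pi.single i 1) (Pi.single j 1)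

/-- The derivative `∂_k g_ij` at `p`. -/
def dGram (p : E3) (k i j : Fin 3) : ℝ :=
  fderiv ℝ (fun q => hypGram q i j) p (Pi.single k 1)

/-- The Christoffel symbols `Γ^k_ij` of the Levi-Civita connection of the hyperbolic metric. -/
def christoffel (p : E3) (k i j : Fin 3) : ℝ :=
  1 / 2 * ∑ l, (hypGram p)⁻¹ k l * (dGram p i j l + dGram p j i l - dGram p l i j)

/-- Riemannian isometries of hyperbolic space onto itself. -/
structure IsHypIsometry (F : E3 → E3) : Prop where
  bijOn : BijOn F H3 H3
  smooth : ContDiffOn ℝ ∞ F H3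
  metric : ∀ p ∈ H3, ∀ v w : E3,
    hypMetric (F p) (fderiv ℝ F p v) (fderiv ℝ F p w) = hypMetric p v w

/-- Two subsets of hyperbolic space are congruent if an isometry takes one onto the other. -/
def HypCongruent (S T : Set E3) : Prop := ∃ F : E3 → E3, IsHypIsometry F ∧ F '' S = T

/-! Parametrized surfaces and their mean curvature in hyperbolic space. -/

/-- The coordinate directions of the parameter plane. -/
def dir : Fin 2 → ℝ × ℝ := ![(1, 0), (0, 1)]

/-- The coordinate field `∂_a X` at `u`. -/
def tangent (X : ℝ × ℝ → E3) (a : Fin 2) (u : ℝ × ℝ) : E3 := fderiv ℝ X u (dir a)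

/-- The covariant derivative of `∂_b X` in the direction `∂_a X`, for the Levi-Civita
connection of the hyperbolic metric. -/
def covTangent (X : ℝ × ℝ → E3) (a b : Fin 2) (u : ℝ × ℝ) : E3 := fun k =>
  fderiv ℝ (tangent X b) u (dir a) k +
    ∑ i, ∑ j, christoffel (X u) k i j * tangent X a u i * tangent X b u j

/-- The first fundamental form. -/
def firstForm (X : ℝ × ℝ → E3) (u : ℝ × ℝ) : Matrix (Fin 2) (Fin 2) ℝ :=
  Matrix.of fun a b => hypMetric (X u) (tangent X a u) (tangent X b u)

/-- The second fundamental form with respect to the normal `η`: the entry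
`⟨∇_a ∂_b X, η⟩ = ⟨-∇_a η, ∂_b X⟩` is the form of the shape operator `-∇η`. -/
def secondForm (X : ℝ × ℝ → E3) (η : E3) (u : ℝ × ℝ) : Matrix (Fin 2) (Fin 2) ℝ :=
  Matrix.of fun a b => hypMetric (X u) (covTangent X a b u) η

/-- The hyperbolic mean curvature `(k₁ + k₂) / 2` with respect to the unit normal `η`: half
the trace of the shape operator. -/
def meanCurvature (X : ℝ × ℝ → E3) (η : E3) (u : ℝ × ℝ) : ℝ :=
  ((firstForm X u)⁻¹ * secondForm X η u).trace / 2

/-- `η` is a unit normal at the point with parameter `u`, for the hyperbolic metric. -/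
def IsUnitNormal (X : ℝ × ℝ → E3) (u : ℝ × ℝ) (η : E3) : Prop :=
  hypMetric (X u) η η = 1 ∧ ∀ a, hypMetric (X u) η (tangent X a u) = 0

/-- Mean curvature flow (for all times) in hyperbolic space: a smooth family of immersions
whose velocity has normal component equal to the mean curvature vector, that is
`⟨∂X_t/∂t, η⟩ = H`. Both sides change sign with `η`, so the choice of `η` is immaterial. -/
structure IsMCF (X : ℝ → ℝ × ℝ → E3) : Prop where
  smooth : ContDiff ℝ ∞ (fun q : ℝ × (ℝ × ℝ) => X q.1 q.2)
  mem : ∀ t u, X t u ∈ H3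
  immersion : ∀ t u, Function.Injective (fderiv ℝ (X t) u)
  flow : ∀ t u η, IsUnitNormal (X t) u η →
    hypMetric (X t u) (deriv (fun τ => X τ u) t) η = meanCurvature (X t) η u

/-- The parametrized surface `X` is a translator: it moves by mean curvature under the
hyperbolic translations `p ↦ e^t p` along the `z`-axis. -/
def IsTranslator (X : ℝ × ℝ → E3) : Prop := IsMCF (fun t u => Real.exp t • X u)

/-- `X`, of period `2π` in its first variable, induces a smooth proper embedding of the annulus
`(ℝ / 2πℤ) × ℝ` into hyperbolic space with image `S`. -/
structure IsProperAnnulus (X : ℝ × ℝ → E3) (S : Set E3) : Prop where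
  smooth : ContDiff ℝ ∞ X
  mem : ∀ u, X u ∈ H3
  immersion : ∀ u, Function.Injective (fderiv ℝ X u)
  injective : ∀ u v : ℝ × ℝ, X u = X v ↔ u.2 = v.2 ∧ ∃ k : ℤ, v.1 = u.1 + 2 * Real.pi * k
  proper : ∀ K : Set E3, IsCompact K → K ⊆ H3 → ∃ c : ℝ, ∀ u, X u ∈ K → |u.2| ≤ c
  range_eq : range X = S

/-- `S` is a properly embedded annular translator. -/
def IsProperAnnularTranslator (S : Set E3) : Prop :=
  ∃ X : ℝ × ℝ → E3, IsProperAnnulus X S ∧ IsTranslator X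

/-- The rotation by the angle `θ` about the `z`-axis. -/
def rotZ (θ : ℝ) (p : E3) : E3 :=
  ![Real.cos θ * p 0 - Real.sin θ * p 1, Real.sin θ * p 0 + Real.cos θ * p 1, p 2]

/-- Invariance under all rotations about the `z`-axis. -/
def IsRotational (S : Set E3) : Prop := ∀ θ : ℝ, rotZ θ '' S = S

/-! Horospheres, asymptotic boundary, vertical graphs. -/

/-- The horosphere at height `h`. -/
def horosphere (h : ℝ) : Set E3 := {p | p 2 = h}

/-- The sphere at infinity `{z = 0} ∪ {∞}`, inside the one-point compactification of `ℝ³`. -/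
def idealBoundary : Set (OnePoint E3) :=
  insert OnePoint.infty ((fun p : E3 => (p : OnePoint E3)) '' {p | p 2 = 0})

/-- The asymptotic boundary of a subset of hyperbolic space. -/
def asymptoticBoundary (S : Set E3) : Set (OnePoint E3) :=
  closure ((fun p : E3 => (p : OnePoint E3)) '' S) ∩ idealBoundary

/-- The vertical graph of `u` over the set `Ω` of points `(x, y)`. -/
def vGraph (Ω : Set (ℝ × ℝ)) (u : ℝ × ℝ → ℝ) : Set E3 :=
  {p | (p 0, p 1) ∈ Ω ∧ p 2 = u (p 0, p 1)}

/-- The complement of the open disk of radius `r` about the origin. -/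
def closedExterior (r : ℝ) : Set (ℝ × ℝ) := {q | r ^ 2 ≤ q.1 ^ 2 + q.2 ^ 2}

/-- The complement of the closed disk of radius `r` about the origin. -/
def openExterior (r : ℝ) : Set (ℝ × ℝ) := {q | r ^ 2 < q.1 ^ 2 + q.2 ^ 2}

/-- The circle of radius `r` about the `z`-axis in the horosphere at height `1`. -/
def neckCircle (r : ℝ) : Set E3 := {p | p 0 ^ 2 + p 1 ^ 2 = r ^ 2 ∧ p 2 = 1}

/-- The `C^{2,α}` norm of `f` on the set `C` (for `f` twice differentiable near `C`). -/
def c2HolderNorm (α : ℝ) (C : Set (ℝ × ℝ)) (f : ℝ × ℝ → ℝ) : ℝ≥0∞ :=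
  (∑ k ∈ Finset.range 3, ⨆ x ∈ C, ‖iteratedFDeriv ℝ k f x‖ₑ) +
    ⨆ x ∈ C, ⨆ y ∈ C, ‖iteratedFDeriv ℝ 2 f x - iteratedFDeriv ℝ 2 f y‖ₑ / edist x y ^ α

end HypTranslator

end

open HypTranslator

/-!
A surface of revolution about the `z`-axis whose generating curve has tangent angle `θ` translates
along the axis under mean curvature flow iff `dθ/ds = -sin θ (1 / ρ + 2 ρ / z²)` in Euclidean arc
length `s` (`revolution_meanCurvature`, `IsProfile.isTranslator`). Along a curve that is not
horizontal `θ` decreases strictly, so it serves as a parameter; writing `cot θ = sinh t` turns the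
equation into
`ρ' = A tanh t`, `z' = A / cosh t`, `A = ρ z² / (z² + 2 ρ²)`,
which in the coordinates `log ρ`, `log z` has a bounded right-hand side. Hence there is a solution
on the whole line through the neck `(ρ, z) = (r, 1)` at `t = 0` (`exists_isProfile`), and the
surface generated by it is the translator `Σ_r`. Its two sheets are the halves `t ≥ 0` and `t ≤ 0`;
reflecting `t` exchanges them at the cost of a sign `σ` in the equation of `z`, so that all
estimates are made once, on `t ≥ 0`.

With `y = ρ / z` one has `(log z)' = y / ((1 + 2 y²) cosh t)`. The factor `1 / cosh t` makes the
height bounded above and away from zero. The bounds `y / (1 + 2 y²) ≤ 1 / (2 y)` with `ρ ≥ r`, and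
`y / (1 + 2 y²) ≤ √y` with `ρ ≤ r cosh t`, make the variation of `log z` small for large and for
small `r` respectively (`IsProfile.abs_log_z_le_div`, `IsProfile.abs_log_z_le_sqrt`). As a function
`g` of `w = ρ²` the height is smooth outside the neck, where `|g'|` is of the order of `r`, and
`g'' / g'`, `g''' / g'` are continuous functions of `w`, `g` and `g'`; so the height converges to
`1` with three derivatives as `r → 0`, which controls the Hölder norms
(`eventually_heightOf_small`, `c2HolderNorm_le`).

For noncongruence, an isometry preserves the function `2 (cosh d - 1) = |p - q|² / (p₂ q₂)` of the
hyperbolic distance (`IsHypIsometry.exists_pair`). Therefore `z / (z ∘ F)` is a polynomial in the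
coordinates of degree two, a multiple of `|p|²` plus an affine function of the horizontal
coordinates. Both surfaces lie in slabs, so this polynomial is bounded on the first surface, which
is horizontally unbounded in all directions: it is constant. Hence `F` acts on horizontal
coordinates as a similarity and maps vertical lines to vertical lines. The neck is the part of the
surface that vertical lines meet only once and has height `1` in both surfaces, so `F` preserves
heights and the radii of the necks agree (`radius_eq_of_hypCongruent`).
-/

namespace HypTranslator

/-! ### Global solutions of bounded autonomous equations -/

open Manifold in
/-- A bounded `C¹` vector field on a finite-dimensional space is complete. -/
theorem exists_global_solution {E : Type*} [NormedAddCommGroup E] [NormedSpace ℝ E]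
    [FiniteDimensional ℝ E] {v : E → E} (hv : ContDiff ℝ 1 v) {C : ℝ} (hC : ∀ x, ‖v x‖ ≤ C)
    (x₀ : E) : ∃ γ : ℝ → E, γ 0 = x₀ ∧ ∀ t, HasDerivAt γ (v (γ t)) t := by
  have : CompleteSpace E := FiniteDimensional.complete ℝ E
  have hC0 : 0 ≤ C := (norm_nonneg _).trans (hC x₀)
  have hloc : ∀ x : E, ∃ γ : ℝ → E, γ 0 = x ∧
      IsMIntegralCurveOn (I := 𝓘(ℝ, E)) (M := E) γ v (Ioo (-1) 1) := by
    intro x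
    -- a solution that starts at `x` stays in the ball of radius `C` for at least the time `1`
    obtain ⟨K, hK⟩ := (hv.locallyLipschitz.locallyLipschitzOn
      (s := Metric.closedBall x C)).exists_lipschitzOnWith_of_compact (isCompact_closedBall x C)
    have hP : IsPicardLindelof (fun _ : ℝ => v) (tmin := -1) (tmax := 1)
        ⟨0, by constructor <;> norm_num⟩ x ⟨C, hC0⟩ 0 ⟨C, hC0⟩ K := by
      refine .of_time_independent (fun y _ => hC y) hK ?_
      simp
    obtain ⟨γ, h0, hγ⟩ := hP.exists_eq_forall_mem_Icc_hasDerivWithinAt₀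
    refine ⟨γ, h0, fun t ht => ?_⟩
    have h := ((hγ t (Ioo_subset_Icc_self ht)).hasDerivAt (Icc_mem_nhds ht.1 ht.2))
    exact hasMFDerivWithinAt_iff_hasFDerivWithinAt.2 (HasDerivAt.hasFDerivAt h).hasFDerivWithinAt
  -- local solutions with a uniform time of existence extend to the whole line
  obtain ⟨γ, h0, hγ⟩ := exists_isMIntegralCurve_of_isMIntegralCurveOn (I := 𝓘(ℝ, E)) (M := E)
    (v := v) (contMDiff_vectorSpace_iff_contDiff.2 hv) one_pos hloc x₀
  refine ⟨γ, h0, fun t => ?_⟩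
  have h : HasFDerivAt γ ((1 : ℝ →L[ℝ] ℝ).smulRight (v (γ t))) t :=
    hasMFDerivAt_iff_hasFDerivAt.1 (hγ t)
  exact h.hasDerivAt.congr_deriv (by simp)

/-! ### The profile curve -/

/-- The common factor `ρ z² / (z² + 2 ρ²)` of the profile equations. -/
noncomputable def speed (ρ z : ℝ) : ℝ := ρ * z ^ 2 / (z ^ 2 + 2 * ρ ^ 2)

/-- The generating curve `t ↦ (ρ t, z t)` of a rotational translator whose neck is the circle of
radius `r` at height `1`, in the half-plane of points at distance `ρ` from the axis and height
`z`. The parameter is tied to the angle `θ` of the tangent by `cot θ = σ sinh t`. The sign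
`σ = ± 1` is the direction in which the curve is run: `z` increases for `σ = 1` and decreases for
`σ = -1`, while `t = 0` always is the neck. -/
structure IsProfile (σ r : ℝ) (ρ z : ℝ → ℝ) : Prop where
  sign : σ = 1 ∨ σ = -1
  radius_pos : 0 < r
  ρ_pos : ∀ t, 0 < ρ t
  z_pos : ∀ t, 0 < z t
  ρ_zero : ρ 0 = r
  z_zero : z 0 = 1
  deriv_ρ : ∀ t, HasDerivAt ρ (speed (ρ t) (z t) * Real.tanh t) t
  deriv_z : ∀ t, HasDerivAt z (σ * (speed (ρ t) (z t) / Real.cosh t)) t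

theorem speed_pos {ρ z : ℝ} (hρ : 0 < ρ) (hz : 0 < z) : 0 < speed ρ z := by
  unfold speed; positivity

/-- In the logarithmic coordinates `a = log ρ`, `b = log z` the profile equations have a bounded
smooth right-hand side, so they have a solution on the whole line. -/
theorem exists_isProfile {r : ℝ} (hr : 0 < r) : ∃ ρ z : ℝ → ℝ, IsProfile 1 r ρ z := by
  let v : ℝ × ℝ × ℝ → ℝ × ℝ × ℝ := fun p =>
    (1, Real.tanh p.1 * (1 + 2 * Real.exp (p.2.1 - p.2.2) ^ 2)⁻¹,
      (Real.cosh p.1)⁻¹ * (Real.exp (p.2.1 - p.2.2) * (1 + 2 * Real.exp (p.2.1 - p.2.2) ^ 2)⁻¹))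
  have hne : ∀ p : ℝ × ℝ × ℝ, 1 + 2 * Real.exp (p.2.1 - p.2.2) ^ 2 ≠ 0 := fun p => by positivity
  have hcosh : ∀ p : ℝ × ℝ × ℝ, Real.cosh p.1 ≠ 0 := fun p => (Real.cosh_pos _).ne'
  have hv : ContDiff ℝ 1 v := by
    have h1 : ContDiff ℝ 1 fun p : ℝ × ℝ × ℝ => (1 + 2 * Real.exp (p.2.1 - p.2.2) ^ 2)⁻¹ :=
      ContDiff.inv (by fun_prop) hne
    have h2 : ContDiff ℝ 1 fun p : ℝ × ℝ × ℝ => (Real.cosh p.1)⁻¹ :=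
      ContDiff.inv (Real.contDiff_cosh.comp contDiff_fst) hcosh
    have h3 : ContDiff ℝ 1 fun p : ℝ × ℝ × ℝ => Real.tanh p.1 := by
      simp only [Real.tanh_eq_sinh_div_cosh, div_eq_mul_inv]
      exact (Real.contDiff_sinh.comp contDiff_fst).mul h2
    have h4 : ContDiff ℝ 1 fun p : ℝ × ℝ × ℝ => Real.exp (p.2.1 - p.2.2) := by fun_prop
    exact contDiff_const.prodMk ((h3.mul h1).prodMk (h2.mul (h4.mul h1)))
  have hb : ∀ p, ‖v p‖ ≤ 1 := by
    intro p
    have e := Real.exp_pos (p.2.1 - p.2.2)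
    have hc := Real.one_le_cosh p.1
    refine max_le (by simp [v]) (max_le ?_ ?_)
    · simp only [v]
      rw [norm_mul, norm_inv]
      have h1 : ‖Real.tanh p.1‖ ≤ 1 := by
        rw [Real.norm_eq_abs, abs_le]
        exact ⟨(Real.neg_one_lt_tanh _).le, (Real.tanh_lt_one _).le⟩
      have h2 : 1 ≤ ‖1 + 2 * Real.exp (p.2.1 - p.2.2) ^ 2‖ := by
        rw [Real.norm_of_nonneg (by positivity)]; nlinarith
      exact mul_le_one₀ h1 (by positivity) (inv_le_one_of_one_le₀ h2)
    · simp only [v]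
      rw [Real.norm_of_nonneg (by positivity)]
      refine mul_le_one₀ (inv_le_one_of_one_le₀ hc) (by positivity) ?_
      rw [← div_eq_mul_inv, div_le_one (by positivity)]
      nlinarith [sq_nonneg (Real.exp (p.2.1 - p.2.2) - 1)]
  obtain ⟨γ, h0, hγ⟩ := exists_global_solution hv hb (0, Real.log r, 0)
  have hd1 : ∀ t, HasDerivAt (fun t => (γ t).1) 1 t := fun t => (hγ t).fst
  have hd2 : ∀ t, HasDerivAt (fun t => (γ t).2.1) (v (γ t)).2.1 t := fun t => (hγ t).snd.fst
  have hd3 : ∀ t, HasDerivAt (fun t => (γ t).2.2) (v (γ t)).2.2 t := fun t => (hγ t).snd.snd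
  have ht : ∀ t, (γ t).1 = t := by
    have hdd : ∀ t, HasDerivAt (fun t => (γ t).1 - t) 0 t := fun t => by
      exact ((hd1 t).fun_sub (hasDerivAt_id' t)).congr_deriv (by simp)
    intro t
    have := is_const_of_deriv_eq_zero (fun t => (hdd t).differentiableAt)
      (fun t => (hdd t).deriv) t 0
    simp only [h0] at this
    linarith
  refine ⟨fun t => Real.exp (γ t).2.1, fun t => Real.exp (γ t).2.2, .inl rfl, hr,
    fun t => Real.exp_pos _, fun t => Real.exp_pos _, by simp [h0, Real.exp_log hr], by simp [h0],
    fun t => (hd2 t).exp.congr_deriv ?_, fun t => (hd3 t).exp.congr_deriv ?_⟩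
  · simp only [v, ht, speed, Real.exp_sub]
    have := Real.exp_pos (γ t).2.1
    have := Real.exp_pos (γ t).2.2
    field_simp
  · simp only [v, ht, speed, Real.exp_sub]
    have := Real.exp_pos (γ t).2.1
    have := Real.exp_pos (γ t).2.2
    field_simp

namespace IsProfile

variable {σ r : ℝ} {ρ z : ℝ → ℝ}

/-- Running a profile curve backwards exchanges its two halves. -/
theorem reverse (h : IsProfile σ r ρ z) :
    IsProfile (-σ) r (fun t => ρ (-t)) (fun t => z (-t)) where
  sign := by rcases h.sign with h | h <;> simp [h]
  radius_pos := h.radius_pos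
  ρ_pos t := h.ρ_pos _
  z_pos t := h.z_pos _
  ρ_zero := by simpa using h.ρ_zero
  z_zero := by simpa using h.z_zero
  deriv_ρ t := by
    have := (h.deriv_ρ (-t)).comp t (hasDerivAt_neg t)
    exact this.congr_deriv (by simp [Real.tanh_neg])
  deriv_z t := by
    have := (h.deriv_z (-t)).comp t (hasDerivAt_neg t)
    exact this.congr_deriv (by simp [Real.cosh_neg])

/-- A solution of class `C^n` has derivatives of class `C^n`, so it is of class `C^(n+1)`. -/
theorem contDiff (h : IsProfile σ r ρ z) : ContDiff ℝ ∞ ρ ∧ ContDiff ℝ ∞ z := by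
  suffices H : ∀ n : ℕ, ContDiff ℝ n ρ ∧ ContDiff ℝ n z from
    ⟨contDiff_infty.2 fun n => (H n).1, contDiff_infty.2 fun n => (H n).2⟩
  intro n
  induction n with
  | zero =>
    simp only [Nat.cast_zero, contDiff_zero]
    exact ⟨continuous_iff_continuousAt.2 fun t => (h.deriv_ρ t).continuousAt,
      continuous_iff_continuousAt.2 fun t => (h.deriv_z t).continuousAt⟩
  | succ n ih =>
    have hs : ContDiff ℝ n fun t => speed (ρ t) (z t) :=
      (ih.1.mul (ih.2.pow 2)).div ((ih.2.pow 2).add (contDiff_const.mul (ih.1.pow 2)))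
        fun t => by have := h.ρ_pos t; have := h.z_pos t; positivity
    have hc : ∀ t, Real.cosh t ≠ 0 := fun t => (Real.cosh_pos t).ne'
    have ht : ContDiff ℝ n Real.tanh := by
      have : Real.tanh = fun t => Real.sinh t / Real.cosh t :=
        funext Real.tanh_eq_sinh_div_cosh
      rw [this]
      exact Real.contDiff_sinh.div Real.contDiff_cosh hc
    constructor
    · refine contDiff_succ_iff_deriv (n := n).2
        ⟨fun t => (h.deriv_ρ t).differentiableAt, by simp, ?_⟩
      rw [show deriv ρ = _ from funext fun t => (h.deriv_ρ t).deriv]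
      exact hs.mul ht
    · refine contDiff_succ_iff_deriv (n := n).2
        ⟨fun t => (h.deriv_z t).differentiableAt, by simp, ?_⟩
      rw [show deriv z = _ from funext fun t => (h.deriv_z t).deriv]
      exact contDiff_const.mul (hs.div Real.contDiff_cosh hc)

end IsProfile

/-! ### Hyperbolic distance and isometries -/

/-- The function `2 (cosh d - 1)` of the hyperbolic distance `d` of two points. -/
noncomputable def qDist (p q : E3) : ℝ :=
  ((p 0 - q 0) ^ 2 + (p 1 - q 1) ^ 2 + (p 2 - q 2) ^ 2) / (p 2 * q 2)

theorem qDist_nonneg {p q : E3} (hp : p ∈ H3) (hq : q ∈ H3) : 0 ≤ qDist p q := by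
  have : 0 < p 2 := hp
  have : 0 < q 2 := hq
  unfold qDist; positivity

theorem hypMetric_self (p v : E3) :
    hypMetric p v v = (v 0 ^ 2 + v 1 ^ 2 + v 2 ^ 2) / p 2 ^ 2 := by
  simp only [hypMetric, Fin.sum_univ_three]; ring

/-- The endpoints of a curve of speed at most one, defined on `[0, L]`, have hyperbolic distance at
most `L`. With `c = cosh d` the distance from the initial point, `c' ^ 2 ≤ c ^ 2 - 1`; adding
`ε ^ 2` keeps the root in `arcosh c = log (c + √(c ^ 2 - 1))` differentiable at the start. -/
theorem qDist_le_of_speed_le_one {γ γ' : ℝ → E3} (hγ : ∀ t, γ t ∈ H3)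
    (hd : ∀ t, HasDerivAt γ (γ' t) t) (hs : ∀ t, hypMetric (γ t) (γ' t) (γ' t) ≤ 1)
    {L : ℝ} (hL : 0 ≤ L) : qDist (γ 0) (γ L) ≤ 2 * (Real.cosh L - 1) := by
  have hz : ∀ t, 0 < γ t 2 := hγ
  have hdi : ∀ i t, HasDerivAt (fun t => γ t i) (γ' t i) t := fun i t => hasDerivAt_pi.1 (hd t) i
  set q := γ 0 with hq
  have hq2 : 0 < q 2 := hγ 0
  let c : ℝ → ℝ := fun t => 1 + qDist q (γ t) / 2
  let N : ℝ → ℝ := fun t => (q 0 - γ t 0) ^ 2 + (q 1 - γ t 1) ^ 2 + (q 2 - γ t 2) ^ 2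
  let c' : ℝ → ℝ := fun t =>
    ((γ t 0 - q 0) * γ' t 0 + (γ t 1 - q 1) * γ' t 1 + (γ t 2 - q 2) * γ' t 2) / (q 2 * γ t 2)
      - N t * γ' t 2 / (2 * q 2 * γ t 2 ^ 2)
  have hc1 : ∀ t, 1 ≤ c t := fun t => by
    have := qDist_nonneg (hγ 0) (hγ t)
    simp only [c]; linarith
  have hc : ∀ t, HasDerivAt c (c' t) t := by
    intro t
    have h0 := ((hdi 0 t).const_sub (q 0)).pow 2
    have h1 := ((hdi 1 t).const_sub (q 1)).pow 2
    have h2 := ((hdi 2 t).const_sub (q 2)).pow 2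
    have h := ((((h0.add h1).add h2).div ((hdi 2 t).const_mul (q 2))
      (mul_pos hq2 (hz t)).ne').div_const 2).const_add 1
    refine h.congr_deriv ?_
    have := (hz t).ne'
    have := hq2.ne'
    simp only [c', N, Pi.add_apply, Pi.pow_apply]
    field_simp
    ring
  -- the distance from the initial point changes at most at unit rate
  have hcc : ∀ t, c' t ^ 2 ≤ c t ^ 2 - 1 := by
    intro t
    have hzt := hz t
    have hs' := hs t
    rw [hypMetric_self, div_le_one (by positivity)] at hs'
    -- Cauchy-Schwarz for the differential of `c`, whose squared hyperbolic norm is `c ^ 2 - 1`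
    set g0 := (γ t 0 - q 0) / (q 2 * γ t 2) with hg0
    set g1 := (γ t 1 - q 1) / (q 2 * γ t 2) with hg1
    set g2 := (γ t 2 - q 2) / (q 2 * γ t 2) - N t / (2 * q 2 * γ t 2 ^ 2) with hg2
    have e1 : c' t = g0 * γ' t 0 + g1 * γ' t 1 + g2 * γ' t 2 := by
      simp only [c', hg0, hg1, hg2]; ring
    have e2 : c t ^ 2 - 1 = (g0 ^ 2 + g1 ^ 2 + g2 ^ 2) * γ t 2 ^ 2 := by
      simp only [c, hg0, hg1, hg2, N, qDist]
      field_simp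
      ring
    rw [e1, e2]
    have hG : 0 ≤ g0 ^ 2 + g1 ^ 2 + g2 ^ 2 := by positivity
    calc _ ≤ (g0 ^ 2 + g1 ^ 2 + g2 ^ 2) * (γ' t 0 ^ 2 + γ' t 1 ^ 2 + γ' t 2 ^ 2) := by
          nlinarith [sq_nonneg (g0 * γ' t 1 - g1 * γ' t 0), sq_nonneg (g0 * γ' t 2 - g2 * γ' t 0),
            sq_nonneg (g1 * γ' t 2 - g2 * γ' t 1)]
      _ ≤ _ := mul_le_mul_of_nonneg_left hs' hG
  have key : ∀ ε > 0, c L + √(c L ^ 2 - 1) ≤ (1 + ε) * Real.exp L := by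
    intro ε hε
    have hpos : ∀ t, 0 < c t ^ 2 - 1 + ε ^ 2 := fun t => by nlinarith [hc1 t]
    let s : ℝ → ℝ := fun t => √(c t ^ 2 - 1 + ε ^ 2)
    have hspos : ∀ t, 0 < s t := fun t => Real.sqrt_pos.2 (hpos t)
    have hsum : ∀ t, 0 < c t + s t := fun t => by linarith [hc1 t, hspos t]
    have hψ : ∀ t, HasDerivAt (fun t => t - Real.log (c t + s t)) (1 - c' t / s t) t := by
      intro t
      have h1 : HasDerivAt s (c t * c' t / s t) t := by
        refine (((((hc t).pow 2).sub_const 1).add_const (ε ^ 2)).sqrt (hpos t).ne').congr_deriv ?_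
        simp only [s, Pi.pow_apply]
        field_simp
        norm_num
        ring
      refine ((hasDerivAt_id' t).fun_sub (((hc t).fun_add h1).log (hsum t).ne')).congr_deriv ?_
      have := (hspos t).ne'
      have := (hsum t).ne'
      field_simp
      ring
    have hmono : Monotone fun t => t - Real.log (c t + s t) := by
      refine monotone_of_deriv_nonneg (fun t => (hψ t).differentiableAt) fun t => ?_
      rw [(hψ t).deriv, sub_nonneg, div_le_one (hspos t)]
      refine Real.le_sqrt_of_sq_le ?_
      nlinarith [hcc t]
    have h := hmono hL
    have hc0 : c 0 = 1 := by simp [c, qDist, hq]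
    have hs0 : s 0 = ε := by simp [s, hc0, Real.sqrt_sq hε.le]
    simp only [hc0, hs0] at h
    have h' : Real.log (c L + s L) ≤ Real.log ((1 + ε) * Real.exp L) := by
      rw [Real.log_mul (by positivity) (by positivity), Real.log_exp]; linarith
    have h'' := (Real.log_le_log_iff (hsum L) (by positivity)).1 h'
    have : √(c L ^ 2 - 1) ≤ s L := Real.sqrt_le_sqrt (by nlinarith)
    linarith
  have key0 : c L + √(c L ^ 2 - 1) ≤ Real.exp L := by
    refine le_of_forall_pos_le_add fun δ hδ => ?_
    have := key (δ / Real.exp L) (by positivity)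
    have e : (1 + δ / Real.exp L) * Real.exp L = Real.exp L + δ := by
      have := Real.exp_pos L; field_simp
    linarith
  have hcl : c L ≤ Real.cosh L := by
    by_contra! hlt
    have : Real.sinh L ≤ √(c L ^ 2 - 1) := by
      refine Real.le_sqrt_of_sq_le ?_
      nlinarith [Real.cosh_sq L, Real.cosh_pos L]
    linarith [Real.cosh_add_sinh L]
  simp only [c] at hcl
  linarith

set_option maxHeartbeats 1000000 in
/-- Any two points are joined by a curve of speed at most one whose length is their distance. In
the hyperboloid model `(1 / z, x / z, y / z, (x² + y² + z²) / z)` the unit speed geodesic is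
`cosh t • v + sinh t • n`. -/
theorem exists_geodesic {p q : E3} (hp : p ∈ H3) (hq : q ∈ H3) :
    ∃ (γ γ' : ℝ → E3) (L : ℝ), 0 ≤ L ∧ 2 * (Real.cosh L - 1) = qDist p q ∧ γ 0 = p ∧ γ L = q ∧
      ∀ t, γ t ∈ H3 ∧ HasDerivAt γ (γ' t) t ∧ hypMetric (γ t) (γ' t) (γ' t) ≤ 1 := by
  have hp2 : 0 < p 2 := hp
  have hq2 : 0 < q 2 := hq
  by_cases hpq : p = q
  · subst hpq
    exact ⟨fun _ => p, fun _ => 0, 0, le_rfl, by simp [qDist], rfl, rfl,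
      fun t => ⟨hp, hasDerivAt_const _ _, by simp [hypMetric]⟩⟩
  have hDpos : 0 < qDist p q := by
    rcases (qDist_nonneg hp hq).lt_or_eq with h | h
    · exact h
    · exfalso
      rw [qDist, eq_comm, div_eq_zero_iff] at h
      have h := h.resolve_right (by positivity)
      apply hpq
      funext i
      fin_cases i <;> simp <;>
        nlinarith [sq_nonneg (p 0 - q 0), sq_nonneg (p 1 - q 1), sq_nonneg (p 2 - q 2)]
  obtain ⟨c, hc⟩ : ∃ c, c = 1 + qDist p q / 2 := ⟨_, rfl⟩
  have hc1 : 1 < c := by linarith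
  obtain ⟨s, hs⟩ : ∃ s, s = √(c ^ 2 - 1) := ⟨_, rfl⟩
  have hc2 : 0 < c ^ 2 - 1 := by nlinarith
  have hspos : 0 < s := hs ▸ Real.sqrt_pos.2 hc2
  have hss : s ^ 2 = c ^ 2 - 1 := by rw [hs, Real.sq_sqrt hc2.le]
  have hcosh : Real.cosh (Real.arsinh s) = c := by
    rw [Real.cosh_arsinh, hss]
    rw [show 1 + (c ^ 2 - 1) = c ^ 2 by ring, Real.sqrt_sq (by linarith)]
  have hsinh : Real.sinh (Real.arsinh s) = s := Real.sinh_arsinh s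
  have hD : (p 0 - q 0) ^ 2 + (p 1 - q 1) ^ 2 + (p 2 - q 2) ^ 2 = 2 * (c - 1) * (p 2 * q 2) := by
    rw [hc, qDist]; field_simp; ring
  -- the coordinates of the unit tangent vector `n`, orthogonal to `v`
  obtain ⟨na, hna⟩ : ∃ n, n = (1 / q 2 - c / p 2) / s := ⟨_, rfl⟩
  obtain ⟨n0, hn0⟩ : ∃ n, n = (q 0 / q 2 - c * (p 0 / p 2)) / s := ⟨_, rfl⟩
  obtain ⟨n1, hn1⟩ : ∃ n, n = (q 1 / q 2 - c * (p 1 / p 2)) / s := ⟨_, rfl⟩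
  obtain ⟨nd, hnd⟩ : ∃ n, n = ((q 0 ^ 2 + q 1 ^ 2 + q 2 ^ 2) / q 2
    - c * ((p 0 ^ 2 + p 1 ^ 2 + p 2 ^ 2) / p 2)) / s := ⟨_, rfl⟩
  obtain ⟨va, hva⟩ : ∃ n, n = 1 / p 2 := ⟨_, rfl⟩
  obtain ⟨v0, hv0⟩ : ∃ n, n = p 0 / p 2 := ⟨_, rfl⟩
  obtain ⟨v1, hv1⟩ : ∃ n, n = p 1 / p 2 := ⟨_, rfl⟩
  obtain ⟨vd, hvd⟩ : ∃ n, n = (p 0 ^ 2 + p 1 ^ 2 + p 2 ^ 2) / p 2 := ⟨_, rfl⟩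
  have hvv : va * vd - v0 ^ 2 - v1 ^ 2 = 1 := by
    rw [hva, hvd, hv0, hv1]; field_simp; ring
  have hvn : va * nd + na * vd - 2 * (v0 * n0 + v1 * n1) = 0 := by
    rw [hva, hvd, hv0, hv1, hna, hnd, hn0, hn1]
    field_simp
    linear_combination p 2 * hD
  have hnn : na * nd - n0 ^ 2 - n1 ^ 2 = -1 := by
    rw [hna, hnd, hn0, hn1]
    field_simp
    rw [hss]
    linear_combination (-c * p 2 * q 2) * hD
  have hvapos : 0 < va := by rw [hva]; positivity
  have hle : na ^ 2 ≤ va ^ 2 := by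
    have : va ^ 2 - na ^ 2 = (va * n0 - na * v0) ^ 2 + (va * n1 - na * v1) ^ 2 := by
      linear_combination na ^ 2 * hvv - (va * na) * hvn + va ^ 2 * hnn
    nlinarith [sq_nonneg (va * n0 - na * v0), sq_nonneg (va * n1 - na * v1)]
  have habs := abs_le_of_sq_le_sq' hle hvapos.le
  let a : ℝ → ℝ := fun t => Real.cosh t * va + Real.sinh t * na
  let b0 : ℝ → ℝ := fun t => Real.cosh t * v0 + Real.sinh t * n0
  let b1 : ℝ → ℝ := fun t => Real.cosh t * v1 + Real.sinh t * n1
  have hder : ∀ (x y t : ℝ), HasDerivAt (fun t => Real.cosh t * x + Real.sinh t * y)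
      (Real.sinh t * x + Real.cosh t * y) t := fun x y t =>
    ((Real.hasDerivAt_cosh t).mul_const x).fun_add ((Real.hasDerivAt_sinh t).mul_const y)
  have hapos : ∀ t, 0 < a t := by
    intro t
    have h1 := Real.exp_pos t
    have h2 := Real.exp_pos (-t)
    simp only [a, Real.cosh_eq, Real.sinh_eq]
    have h3 : 0 ≤ va + na := by linarith
    have h4 : 0 ≤ va - na := by linarith
    have e : (Real.exp t + Real.exp (-t)) / 2 * va + (Real.exp t - Real.exp (-t)) / 2 * na =
        (Real.exp t * (va + na) + Real.exp (-t) * (va - na)) / 2 := by ring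
    rw [e]
    rcases h3.lt_or_eq with h | h
    · have := mul_pos h1 h
      have := mul_nonneg h2.le h4
      linarith
    · have := mul_nonneg h1.le h3
      have := mul_pos h2 (by linarith : 0 < va - na)
      linarith
  refine ⟨fun t => ![b0 t / a t, b1 t / a t, 1 / a t], fun t =>
    ![((Real.sinh t * v0 + Real.cosh t * n0) * a t - b0 t * (Real.sinh t * va + Real.cosh t * na))
        / a t ^ 2,
      ((Real.sinh t * v1 + Real.cosh t * n1) * a t - b1 t * (Real.sinh t * va + Real.cosh t * na))
        / a t ^ 2,
      (0 * a t - 1 * (Real.sinh t * va + Real.cosh t * na)) / a t ^ 2], Real.arsinh s,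
    Real.arsinh_nonneg_iff.2 hspos.le, by rw [hcosh, hc]; ring, ?_, ?_, fun t => ⟨?_, ?_, ?_⟩⟩
  · funext i
    fin_cases i <;> simp [a, b0, b1, hva, hv0, hv1] <;> field_simp
  · have e : a (Real.arsinh s) = 1 / q 2 := by
      simp only [a, hcosh, hsinh, hva, hna]; field_simp; ring
    have e0 : b0 (Real.arsinh s) = q 0 / q 2 := by
      simp only [b0, hcosh, hsinh, hv0, hn0]; field_simp; ring
    have e1 : b1 (Real.arsinh s) = q 1 / q 2 := by
      simp only [b1, hcosh, hsinh, hv1, hn1]; field_simp; ring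
    beta_reduce
    rw [e, e0, e1]
    funext i
    fin_cases i <;> simp <;> field_simp
  · exact one_div_pos.2 (hapos t)
  · refine hasDerivAt_pi.2 fun i => ?_
    fin_cases i
    · exact (hder v0 n0 t).fun_div (hder va na t) (hapos t).ne'
    · exact (hder v1 n1 t).fun_div (hder va na t) (hapos t).ne'
    · exact (hasDerivAt_const t (1 : ℝ)).fun_div (hder va na t) (hapos t).ne'
  · have ha := hapos t
    rw [hypMetric_self]
    simp only [Matrix.cons_val_zero, Matrix.cons_val_one, Matrix.cons_val]
    rw [div_le_one (by positivity)]
    refine le_of_eq ?_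
    have hCS := Real.cosh_sq t
    set C := Real.cosh t
    set S := Real.sinh t
    field_simp
    obtain ⟨d, hd⟩ : ∃ d, d = C * vd + S * nd := ⟨_, rfl⟩
    obtain ⟨d', hd'⟩ : ∃ d', d' = S * vd + C * nd := ⟨_, rfl⟩
    have f1 : a t * d - b0 t ^ 2 - b1 t ^ 2 = 1 := by
      simp only [a, b0, b1, hd]
      linear_combination C ^ 2 * hvv + C * S * hvn + S ^ 2 * hnn + hCS
    have f2 : (S * va + C * na) * d + a t * d' = 2 * (b0 t * (S * v0 + C * n0)
        + b1 t * (S * v1 + C * n1)) := by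
      simp only [a, b0, b1, hd, hd']
      linear_combination (2 * C * S) * hvv + (C ^ 2 + S ^ 2) * hvn + (2 * C * S) * hnn
    have f3 : (S * va + C * na) * d' - (S * v0 + C * n0) ^ 2 - (S * v1 + C * n1) ^ 2 = -1 := by
      simp only [hd']
      linear_combination S ^ 2 * hvv + C * S * hvn + C ^ 2 * hnn - hCS
    linear_combination (-(S * va + C * na) ^ 2) * f1 + (a t * (S * va + C * na)) * f2
      - a t ^ 2 * f3

theorem isOpen_H3 : IsOpen H3 := isOpen_lt continuous_const (continuous_apply 2)

/-- A differentiable map that preserves the metric tensor does not increase distances: it maps a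
geodesic to a curve of the same length. -/
theorem qDist_map_le {F : E3 → E3} (hF : MapsTo F H3 H3)
    (hd : ∀ p ∈ H3, DifferentiableAt ℝ F p)
    (hm : ∀ p ∈ H3, ∀ v, hypMetric (F p) (fderiv ℝ F p v) (fderiv ℝ F p v) = hypMetric p v v)
    {p q : E3} (hp : p ∈ H3) (hq : q ∈ H3) : qDist (F p) (F q) ≤ qDist p q := by
  obtain ⟨γ, γ', L, hL, hLD, h0, h1, h⟩ := exists_geodesic hp hq
  have := qDist_le_of_speed_le_one (γ := fun t => F (γ t))
    (γ' := fun t => fderiv ℝ F (γ t) (γ' t)) (fun t => hF (h t).1)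
    (fun t => (hd _ (h t).1).hasFDerivAt.comp_hasDerivAt t (h t).2.1)
    (fun t => (hm _ (h t).1 _).le.trans (h t).2.2) hL
  simpa only [h0, h1, hLD] using this

/-- Mutually inverse bijections of hyperbolic space that preserve distances. -/
structure IsIsometryPair (F G : E3 → E3) : Prop where
  mapsTo : MapsTo F H3 H3
  mapsTo_inv : MapsTo G H3 H3
  left_inv : ∀ p ∈ H3, G (F p) = p
  right_inv : ∀ p ∈ H3, F (G p) = p
  qDist_eq : ∀ p ∈ H3, ∀ q ∈ H3, qDist (F p) (F q) = qDist p q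

theorem IsIsometryPair.symm {F G : E3 → E3} (h : IsIsometryPair F G) : IsIsometryPair G F where
  mapsTo := h.mapsTo_inv
  mapsTo_inv := h.mapsTo
  left_inv := h.right_inv
  right_inv := h.left_inv
  qDist_eq p hp q hq := by
    rw [← h.qDist_eq _ (h.mapsTo_inv hp) _ (h.mapsTo_inv hq), h.right_inv p hp, h.right_inv q hq]

theorem hypMetric_self_eq_zero {p v : E3} (hp : p ∈ H3) (h : hypMetric p v v = 0) : v = 0 := by
  have hp2 : 0 < p 2 := hp
  rw [hypMetric_self, div_eq_zero_iff] at h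
  have h := h.resolve_right (by positivity)
  funext i
  fin_cases i <;> simp <;> nlinarith [sq_nonneg (v 0), sq_nonneg (v 1), sq_nonneg (v 2)]

/-- A Riemannian isometry preserves distances, since neither it nor its inverse, which is
differentiable by the inverse function theorem, increases them. -/
theorem IsHypIsometry.exists_pair {F : E3 → E3} (hF : IsHypIsometry F) :
    ∃ G, IsIsometryPair F G := by
  classical
  let G := Function.invFunOn F H3
  have hGm : MapsTo G H3 H3 := fun y hy => Function.invFunOn_mem (hF.bijOn.surjOn hy)
  have hFG : ∀ y ∈ H3, F (G y) = y := fun y hy => Function.invFunOn_eq (hF.bijOn.surjOn hy)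
  have hGF : ∀ x ∈ H3, G (F x) = x := fun x hx =>
    hF.bijOn.injOn (hGm (hF.bijOn.mapsTo hx)) hx (hFG _ (hF.bijOn.mapsTo hx))
  have hFs : ∀ p ∈ H3, ContDiffAt ℝ ∞ F p := fun p hp =>
    hF.smooth.contDiffAt (isOpen_H3.mem_nhds hp)
  have hG : ∀ y ∈ H3, ∃ G' : E3 →L[ℝ] E3, HasFDerivAt G G' y ∧
      ∀ v, fderiv ℝ F (G y) (G' v) = v := by
    intro y hy
    have hx := hGm hy
    have hstrict : HasStrictFDerivAt F (fderiv ℝ F (G y)) (G y) :=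
      (hFs _ hx).hasStrictFDerivAt (by simp)
    have hinj : Function.Injective (fderiv ℝ F (G y)).toLinearMap := by
      rw [← LinearMap.ker_eq_bot, LinearMap.ker_eq_bot']
      intro v hv
      have hv' : fderiv ℝ F (G y) v = 0 := hv
      refine hypMetric_self_eq_zero hx ?_
      rw [← hF.metric _ hx, hv']
      simp [hypMetric]
    let e : E3 ≃L[ℝ] E3 := (LinearEquiv.ofInjectiveEndo _ hinj).toContinuousLinearEquiv
    have he : (e : E3 →L[ℝ] E3) = fderiv ℝ F (G y) := by
      ext v; rfl
    rw [← he] at hstrict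
    have hloc : HasStrictFDerivAt G (e.symm : E3 →L[ℝ] E3) (F (G y)) := by
      refine hstrict.to_local_left_inverse ?_
      filter_upwards [isOpen_H3.mem_nhds hx] with x hx using hGF x hx
    rw [hFG y hy] at hloc
    refine ⟨_, hloc.hasFDerivAt, fun v => ?_⟩
    rw [← he]
    exact e.apply_symm_apply v
  refine ⟨G, hF.bijOn.mapsTo, hGm, hGF, hFG, fun p hp q hq => le_antisymm ?_ ?_⟩
  · exact qDist_map_le hF.bijOn.mapsTo (fun x hx => (hFs x hx).differentiableAt (by simp))
      (fun x hx v => hF.metric x hx v v) hp hq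
  · have := qDist_map_le hGm (fun y hy => (hG y hy).choose_spec.1.differentiableAt)
      (fun y hy v => by
        obtain ⟨G', h1, h2⟩ := hG y hy
        have h3 := hF.metric (G y) (hGm hy) (G' v) (G' v)
        rw [h2, hFG y hy] at h3
        rw [h1.fderiv, h3]) (hF.bijOn.mapsTo hp) (hF.bijOn.mapsTo hq)
    rwa [hGF p hp, hGF q hq] at this

/-- Distances to the two points `(0, 0, 1)` and `(0, 0, 2)` determine the height, and each of
these distances, seen from the other side of the isometry, is a quadratic polynomial divided by
the height. -/
theorem IsIsometryPair.height_eq {F G : E3 → E3} (h : IsIsometryPair F G) :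
    ∃ a b₀ b₁ c : ℝ, ∀ p ∈ H3,
      p 2 = F p 2 * (a + b₀ * p 0 + b₁ * p 1 + c * (p 0 ^ 2 + p 1 ^ 2 + p 2 ^ 2)) := by
  have hx₁ : (![0, 0, 1] : E3) ∈ H3 := by simp [H3]
  have hx₂ : (![0, 0, 2] : E3) ∈ H3 := by simp [H3]
  obtain ⟨u, hu, hu'⟩ : ∃ u ∈ H3, F u = ![0, 0, 1] := ⟨_, h.mapsTo_inv hx₁, h.right_inv _ hx₁⟩
  obtain ⟨w, hw, hw'⟩ : ∃ w ∈ H3, F w = ![0, 0, 2] := ⟨_, h.mapsTo_inv hx₂, h.right_inv _ hx₂⟩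
  have hu2 : 0 < u 2 := hu
  have hw2 : 0 < w 2 := hw
  refine ⟨(2 * (w 0 ^ 2 + w 1 ^ 2 + w 2 ^ 2) / w 2 - (u 0 ^ 2 + u 1 ^ 2 + u 2 ^ 2) / u 2) / 3,
    (-4 * w 0 / w 2 + 2 * u 0 / u 2) / 3, (-4 * w 1 / w 2 + 2 * u 1 / u 2) / 3,
    (2 / w 2 - 1 / u 2) / 3, fun p hp => ?_⟩
  have hp2 : 0 < p 2 := hp
  have hP2 : 0 < F p 2 := h.mapsTo hp
  have e1 := h.qDist_eq p hp u hu
  have e2 := h.qDist_eq p hp w hw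
  rw [hu'] at e1
  rw [hw'] at e2
  simp only [qDist, Matrix.cons_val_zero, Matrix.cons_val_one, Matrix.cons_val] at e1 e2
  rw [div_eq_div_iff (by positivity) (by positivity)] at e1 e2
  field_simp
  linear_combination u 2 * e2 - w 2 * e1

/-- The features of a surface of revolution with neck of radius `r` at height `1` that
distinguish it up to congruence: it lies in a slab between horospheres, it contains circles about
the axis of arbitrarily large radius, and each vertical line that it meets lies outside the open
`r`-disk and meets it more than once, except over the neck circle, where the height is `1`. -/
structure HasNeck (r : ℝ) (S : Set E3) : Prop where
  radius_pos : 0 < r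
  slab : ∃ m M : ℝ, 0 < m ∧ ∀ p ∈ S, m ≤ p 2 ∧ p 2 ≤ M
  large : ∀ B : ℝ, ∃ R > B, ∃ z : ℝ, ∀ p : E3, p 0 ^ 2 + p 1 ^ 2 = R ^ 2 → p 2 = z → p ∈ S
  neck : ∀ p : E3, p 0 ^ 2 + p 1 ^ 2 = r ^ 2 → (p ∈ S ↔ p 2 = 1)
  outside : ∀ p ∈ S, r ^ 2 ≤ p 0 ^ 2 + p 1 ^ 2
  double : ∀ p ∈ S, r ^ 2 < p 0 ^ 2 + p 1 ^ 2 → ∃ q ∈ S, q ≠ p ∧ q 0 = p 0 ∧ q 1 = p 1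

theorem HasNeck.subset_H3 {r : ℝ} {S : Set E3} (h : HasNeck r S) : S ⊆ H3 := by
  obtain ⟨m, M, hm, hS⟩ := h.slab
  exact fun p hp => hm.trans_le (hS p hp).1

/-- If the heights of `S` and of its image are bounded above and away from zero, the isometry
multiplies all heights by a constant. -/
theorem IsIsometryPair.height_eq_mul {F G : E3 → E3} (h : IsIsometryPair F G) {r r' : ℝ}
    {S S' : Set E3} (hS : HasNeck r S) (hS' : HasNeck r' S') (hFS : MapsTo F S S') :
    ∃ a : ℝ, ∀ p ∈ H3, p 2 = F p 2 * a := by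
  obtain ⟨a, b₀, b₁, c, hf⟩ := h.height_eq
  obtain ⟨m, M, hm, hM⟩ := hS.slab
  obtain ⟨m', M', hm', hM'⟩ := hS'.slab
  have hb : ∀ p ∈ S, |a + b₀ * p 0 + b₁ * p 1 + c * (p 0 ^ 2 + p 1 ^ 2 + p 2 ^ 2)| ≤ M / m' := by
    intro p hp
    have h1 := hf p (hS.subset_H3 hp)
    have h2 := (hM' _ (hFS hp)).1
    have h3 : a + b₀ * p 0 + b₁ * p 1 + c * (p 0 ^ 2 + p 1 ^ 2 + p 2 ^ 2) = p 2 / F p 2 := by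
      rw [eq_div_iff (by linarith), mul_comm]; exact h1.symm
    have h4 := hM p hp
    rw [h3, abs_of_nonneg (by apply div_nonneg <;> linarith)]
    exact div_le_div₀ (by linarith) h4.2 hm' h2
  have hp4 : ∀ B, ∃ R > B, ∃ z, (|z| ≤ M) ∧
      |a + b₀ * R + c * (R ^ 2 + z ^ 2)| ≤ M / m' ∧ |a - b₀ * R + c * (R ^ 2 + z ^ 2)| ≤ M / m' ∧
      |a + b₁ * R + c * (R ^ 2 + z ^ 2)| ≤ M / m' ∧
        |a - b₁ * R + c * (R ^ 2 + z ^ 2)| ≤ M / m' := by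
    intro B
    obtain ⟨R, hR, z, hz⟩ := hS.large B
    have h1 := hz ![R, 0, z] (by simp) (by simp)
    have h2 := hz ![-R, 0, z] (by simp) (by simp)
    have h3 := hz ![0, R, z] (by simp) (by simp)
    have h4 := hz ![0, -R, z] (by simp) (by simp)
    refine ⟨R, hR, z, ?_, ?_, ?_, ?_, ?_⟩
    · have := hM _ h1
      simp only [Matrix.cons_val] at this
      rw [abs_of_nonneg (by linarith)]; exact this.2
    · simpa using hb _ h1
    · simpa [sub_eq_add_neg] using hb _ h2
    · simpa using hb _ h3
    · simpa [sub_eq_add_neg] using hb _ h4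
  -- the values at opposite points of large circles bound the linear coefficients
  have hlin : ∀ b : ℝ, (∀ B, ∃ R > B, |b * R| ≤ M / m') → b = 0 := by
    intro b hb
    by_contra hne
    have hpos : 0 < |b| := abs_pos.2 hne
    obtain ⟨R, hR, hRb⟩ := hb (max 0 (M / m' / |b|))
    have hR0 : 0 < R := (le_max_left _ _).trans_lt hR
    rw [abs_mul, abs_of_pos hR0] at hRb
    have := (div_lt_iff₀ hpos).1 ((le_max_right _ _).trans_lt hR)
    linarith
  have hb0 : b₀ = 0 := hlin _ fun B => by
    obtain ⟨R, hR, z, -, h1, h2, -⟩ := hp4 B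
    refine ⟨R, hR, ?_⟩
    rw [abs_le] at *
    constructor <;> linarith
  have hb1 : b₁ = 0 := hlin _ fun B => by
    obtain ⟨R, hR, z, -, -, -, h1, h2⟩ := hp4 B
    refine ⟨R, hR, ?_⟩
    rw [abs_le] at *
    constructor <;> linarith
  have hc : c = 0 := by
    by_contra hne
    have hpos : 0 < |c| := abs_pos.2 hne
    obtain ⟨R, hR, z, hz, h1, h2, -⟩ := hp4 (max 1 ((M / m' + |a|) / |c|))
    have hR1 : 1 < R := (le_max_left _ _).trans_lt hR
    have h3 : |c * (R ^ 2 + z ^ 2)| ≤ M / m' + |a| := by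
      have := le_abs_self a
      have := neg_abs_le a
      rw [abs_le] at *
      constructor <;> linarith
    rw [abs_mul, abs_of_pos (by positivity : 0 < R ^ 2 + z ^ 2)] at h3
    have := (div_lt_iff₀ hpos).1 ((le_max_right _ _).trans_lt hR)
    nlinarith [mul_pos hpos (by linarith : 0 < R - 1), sq_nonneg z,
      mul_nonneg hpos.le (sq_nonneg z)]
  refine ⟨a, fun p hp => ?_⟩
  have := hf p hp
  rw [hb0, hb1, hc] at this
  simpa using this

/-- An isometry between two such surfaces maps the fibres of the projection along the axis to
fibres, hence the neck to the neck, and it preserves heights because the necks have the same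
height. The diameters of the necks are compared. -/
theorem IsIsometryPair.radius_le {F G : E3 → E3} (h : IsIsometryPair F G) {r r' : ℝ}
    {S S' : Set E3} (hS : HasNeck r S) (hS' : HasNeck r' S') (hFS : MapsTo F S S')
    (hGS : MapsTo G S' S) : r ≤ r' := by
  obtain ⟨a, ha⟩ := h.height_eq_mul hS hS' hFS
  have hr := hS.radius_pos
  have hr' := hS'.radius_pos
  have hane : a ≠ 0 := by
    rintro rfl
    have := ha ![0, 0, 1] (by simp [H3])
    simp at this
  -- the horizontal part of the map is a similarity
  have hdist : ∀ p ∈ H3, ∀ q ∈ H3, (p 0 - q 0) ^ 2 + (p 1 - q 1) ^ 2 =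
      a ^ 2 * ((F p 0 - F q 0) ^ 2 + (F p 1 - F q 1) ^ 2) := by
    intro p hp q hq
    have h1 := h.qDist_eq p hp q hq
    have hp2 : 0 < F p 2 := h.mapsTo hp
    have hq2 : 0 < F q 2 := h.mapsTo hq
    have hp2' : 0 < p 2 := hp
    have hq2' : 0 < q 2 := hq
    rw [qDist, qDist, div_eq_div_iff (by positivity) (by positivity), ha p hp, ha q hq] at h1
    have hne : F p 2 * F q 2 ≠ 0 := by positivity
    refine mul_left_cancel₀ hne ?_
    linear_combination -h1
  have hneck : ∀ p : E3, p 0 ^ 2 + p 1 ^ 2 = r ^ 2 → p 2 = 1 →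
      F p 0 ^ 2 + F p 1 ^ 2 = r' ^ 2 ∧ F p 2 = 1 := by
    intro p hp hp2
    have hpS : p ∈ S := (hS.neck p hp).2 hp2
    have hFp := hFS hpS
    have hcirc : F p 0 ^ 2 + F p 1 ^ 2 = r' ^ 2 := by
      by_contra hne
      obtain ⟨q, hq, hqne, hq0, hq1⟩ :=
        hS'.double _ hFp (lt_of_le_of_ne (hS'.outside _ hFp) (Ne.symm hne))
      have hqH := hS'.subset_H3 hq
      have hd := hdist p (hS.subset_H3 hpS) (G q) (h.mapsTo_inv hqH)
      rw [h.right_inv q hqH, hq0, hq1] at hd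
      have e0 : G q 0 = p 0 := by
        nlinarith [sq_nonneg (p 0 - G q 0), sq_nonneg (p 1 - G q 1)]
      have e1 : G q 1 = p 1 := by
        nlinarith [sq_nonneg (p 0 - G q 0), sq_nonneg (p 1 - G q 1)]
      have e2 : G q 2 = 1 := (hS.neck (G q) (by rw [e0, e1, hp])).1 (hGS hq)
      have : G q = p := by
        funext i
        fin_cases i <;> simp [e0, e1, e2, hp2]
      exact hqne (by rw [← h.right_inv q hqH, this])
    exact ⟨hcirc, (hS'.neck _ hcirc).1 hFp⟩
  have h1 := hneck ![r, 0, 1] (by simp) (by simp)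
  have h2 := hneck ![-r, 0, 1] (by simp) (by simp)
  have hH1 : (![r, 0, 1] : E3) ∈ H3 := by simp [H3]
  have hH2 : (![-r, 0, 1] : E3) ∈ H3 := by simp [H3]
  have ha1 : a = 1 := by
    have := ha _ hH1
    rw [h1.2] at this
    simpa using this.symm
  have hd := hdist _ hH1 _ hH2
  rw [ha1] at hd
  simp only [Matrix.cons_val_zero, Matrix.cons_val_one] at hd
  obtain ⟨h1, -⟩ := h1
  obtain ⟨h2, -⟩ := h2
  set P := F ![r, 0, 1]
  set Q := F ![-r, 0, 1]
  refine le_of_sq_le_sq ?_ hr'.le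
  nlinarith [sq_nonneg (P 0 + Q 0), sq_nonneg (P 1 + Q 1)]

theorem radius_eq_of_hypCongruent {r r' : ℝ} {S S' : Set E3} (hS : HasNeck r S)
    (hS' : HasNeck r' S') (h : HypCongruent S S') : r = r' := by
  obtain ⟨F, hF, rfl⟩ := h
  obtain ⟨G, hFG⟩ := hF.exists_pair
  have h1 : MapsTo F S (F '' S) := mapsTo_image F S
  have h2 : MapsTo G (F '' S) S := by
    rintro _ ⟨p, hp, rfl⟩
    rwa [hFG.left_inv p (hS.subset_H3 hp)]
  exact le_antisymm (hFG.radius_le hS hS' h1 h2) (hFG.symm.radius_le hS' hS h2 h1)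

/-! ### Mean curvature of surfaces of revolution -/

theorem hypGram_eq (p : E3) (i j : Fin 3) : hypGram p i j = if i = j then 1 / p 2 ^ 2 else 0 := by
  fin_cases i <;> fin_cases j <;> simp [hypGram, hypMetric, Fin.sum_univ_three]

theorem dGram_eq {p : E3} (hp : p ∈ H3) (k i j : Fin 3) :
    dGram p k i j = if i = j ∧ k = 2 then -2 / p 2 ^ 3 else 0 := by
  have hp2 : p 2 ≠ 0 := (show 0 < p 2 from hp).ne'
  unfold dGram
  by_cases hij : i = j
  · have h : HasFDerivAt (fun q : E3 => hypGram q i j)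
        ((-2 / p 2 ^ 3) • (ContinuousLinearMap.proj (R := ℝ) (φ := fun _ : Fin 3 => ℝ) 2)) p := by
      have h1 : (fun q : E3 => hypGram q i j) = fun q => (q 2 ^ 2)⁻¹ := by
        funext q; simp [hypGram_eq, hij]
      rw [h1]
      have h2 : HasDerivAt (fun x : ℝ => (x ^ 2)⁻¹) (-2 / p 2 ^ 3) (p 2) := by
        refine ((hasDerivAt_pow 2 (p 2)).fun_inv (by positivity)).congr_deriv ?_
        field_simp
        norm_num
        ring
      have h3 : HasFDerivAt (fun q : E3 => q 2)
          (ContinuousLinearMap.proj (R := ℝ) (φ := fun _ : Fin 3 => ℝ) 2) p :=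
        (ContinuousLinearMap.proj (R := ℝ) (φ := fun _ : Fin 3 => ℝ) 2).hasFDerivAt
      exact HasDerivAt.comp_hasFDerivAt (h₂ := fun x : ℝ => (x ^ 2)⁻¹) p h2 h3
    rw [h.fderiv]
    by_cases hk : k = 2 <;> simp [hij, hk, eq_comm]
  · have h1 : (fun q : E3 => hypGram q i j) = fun q => 0 := by
      funext q; simp [hypGram_eq, hij]
    rw [h1]
    simp [hij]

theorem hypGram_inv_eq {p : E3} (hp : p ∈ H3) :
    (hypGram p)⁻¹ = Matrix.diagonal fun _ => p 2 ^ 2 := by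
  have hp2 : p 2 ≠ 0 := (show 0 < p 2 from hp).ne'
  have h : hypGram p = Matrix.diagonal fun _ => 1 / p 2 ^ 2 := by
    ext i j; rw [hypGram_eq, Matrix.diagonal_apply]
  rw [h]
  refine Matrix.inv_eq_right_inv ?_
  rw [Matrix.diagonal_mul_diagonal, ← Matrix.diagonal_one]
  congr 1
  funext i
  field_simp

/-- The quadratic part of the Levi-Civita connection:
`Γ(v, w) = -(w₂ v + v₂ w - (v ⬝ w) e₂) / z`. -/
theorem sum_christoffel {p : E3} (hp : p ∈ H3) (v w : E3) (k : Fin 3) :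
    ∑ i, ∑ j, christoffel p k i j * v i * w j =
      -(w 2 * v k + v 2 * w k - (if k = 2 then ∑ i, v i * w i else 0)) / p 2 := by
  have hp2 : p 2 ≠ 0 := (show 0 < p 2 from hp).ne'
  simp only [christoffel, hypGram_inv_eq hp, dGram_eq hp, Fin.sum_univ_three,
    Matrix.diagonal_apply]
  fin_cases k <;> simp <;> field_simp <;> ring

/-- The surface of revolution about the `z`-axis generated by the curve `t ↦ (R t, Z t)`. -/
noncomputable def revolution (R Z : ℝ → ℝ) (u : ℝ × ℝ) : E3 :=
  ![R u.2 * Real.cos u.1, R u.2 * Real.sin u.1, Z u.2]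

theorem revolution_contDiff {R Z : ℝ → ℝ} (hR : ContDiff ℝ ∞ R) (hZ : ContDiff ℝ ∞ Z) :
    ContDiff ℝ ∞ (revolution R Z) := by
  refine contDiff_pi.2 fun i => ?_
  have h1 : ContDiff ℝ ∞ fun u : ℝ × ℝ => R u.2 := hR.comp contDiff_snd
  have h2 : ContDiff ℝ ∞ fun u : ℝ × ℝ => Real.cos u.1 := Real.contDiff_cos.comp contDiff_fst
  have h3 : ContDiff ℝ ∞ fun u : ℝ × ℝ => Real.sin u.1 := Real.contDiff_sin.comp contDiff_fst
  fin_cases i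
  · exact h1.mul h2
  · exact h1.mul h3
  · exact hZ.comp contDiff_snd

theorem fderiv_dir_zero {f : ℝ × ℝ → E3} {u : ℝ × ℝ} {f' : E3} (hf : DifferentiableAt ℝ f u)
    (h : HasDerivAt (fun s => f (s, u.2)) f' u.1) : fderiv ℝ f u (dir 0) = f' := by
  have h1 : HasDerivAt (fun s => (s, u.2)) ((1 : ℝ), (0 : ℝ)) u.1 :=
    (hasDerivAt_id u.1).prodMk (hasDerivAt_const u.1 u.2)
  exact (hf.hasFDerivAt.comp_hasDerivAt u.1 h1).unique h

theorem fderiv_dir_one {f : ℝ × ℝ → E3} {u : ℝ × ℝ} {f' : E3} (hf : DifferentiableAt ℝ f u)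
    (h : HasDerivAt (fun s => f (u.1, s)) f' u.2) : fderiv ℝ f u (dir 1) = f' := by
  have h1 : HasDerivAt (fun s => (u.1, s)) ((0 : ℝ), (1 : ℝ)) u.2 :=
    (hasDerivAt_const u.2 u.1).prodMk (hasDerivAt_id u.2)
  exact (hf.hasFDerivAt.comp_hasDerivAt u.2 h1).unique h

theorem hasDerivAt_vec3 {f g h : ℝ → ℝ} {f' g' h' t : ℝ} (hf : HasDerivAt f f' t)
    (hg : HasDerivAt g g' t) (hh : HasDerivAt h h' t) :
    HasDerivAt (fun s => (![f s, g s, h s] : E3)) ![f', g', h'] t := by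
  refine hasDerivAt_pi.2 fun i => ?_
  fin_cases i
  exacts [hf, hg, hh]

theorem trace_inv_diagonal_mul {a b : ℝ} (ha : a ≠ 0) (hb : b ≠ 0)
    (N : Matrix (Fin 2) (Fin 2) ℝ) :
    ((Matrix.diagonal ![a, b])⁻¹ * N).trace = N 0 0 / a + N 1 1 / b := by
  have h : (Matrix.diagonal ![a, b])⁻¹ = Matrix.diagonal ![a⁻¹, b⁻¹] := by
    refine Matrix.inv_eq_right_inv ?_
    rw [Matrix.diagonal_mul_diagonal, ← Matrix.diagonal_one]
    congr 1
    funext i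
    fin_cases i <;> simp [ha, hb]
  rw [h, Matrix.trace_fin_two]
  simp [Matrix.diagonal_mul, div_eq_inv_mul]

section Revolution

variable {R Z R' Z' R'' Z'' : ℝ → ℝ}

theorem revolution_tangent_zero (hR : ContDiff ℝ ∞ R) (hZ : ContDiff ℝ ∞ Z) (u : ℝ × ℝ) :
    tangent (revolution R Z) 0 u = ![-(R u.2 * Real.sin u.1), R u.2 * Real.cos u.1, 0] := by
  refine fderiv_dir_zero ((revolution_contDiff hR hZ).differentiable (by simp) u) ?_
  refine (hasDerivAt_vec3 ((Real.hasDerivAt_cos u.1).const_mul (R u.2))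
    ((Real.hasDerivAt_sin u.1).const_mul (R u.2)) (hasDerivAt_const u.1 (Z u.2))).congr_deriv ?_
  simp

theorem revolution_tangent_one (hR : ContDiff ℝ ∞ R) (hZ : ContDiff ℝ ∞ Z)
    (hR' : ∀ t, HasDerivAt R (R' t) t) (hZ' : ∀ t, HasDerivAt Z (Z' t) t) (u : ℝ × ℝ) :
    tangent (revolution R Z) 1 u = ![R' u.2 * Real.cos u.1, R' u.2 * Real.sin u.1, Z' u.2] :=
  fderiv_dir_one ((revolution_contDiff hR hZ).differentiable (by simp) u)
    (hasDerivAt_vec3 ((hR' u.2).mul_const (Real.cos u.1))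
      ((hR' u.2).mul_const (Real.sin u.1)) (hZ' u.2))

theorem tangent_differentiable {X : ℝ × ℝ → E3} (hX : ContDiff ℝ ∞ X) (a : Fin 2) :
    Differentiable ℝ (tangent X a) := by
  have h : ContDiff ℝ ∞ (fderiv ℝ X) := hX.fderiv_right (by simp)
  exact fun u => ((h.differentiable (by simp)) u).clm_apply (differentiableAt_const _)

theorem revolution_mem_H3 (hZ : ∀ t, 0 < Z t) (u : ℝ × ℝ) : revolution R Z u ∈ H3 := hZ u.2

theorem revolution_immersion (hR : ContDiff ℝ ∞ R) (hZ : ContDiff ℝ ∞ Z)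
    (hR' : ∀ t, HasDerivAt R (R' t) t) (hZ' : ∀ t, HasDerivAt Z (Z' t) t)
    (hRne : ∀ t, R t ≠ 0) (hZne : ∀ t, Z' t ≠ 0) (u : ℝ × ℝ) :
    Function.Injective (fderiv ℝ (revolution R Z) u) := by
  refine (injective_iff_map_eq_zero _).2 fun v hv => ?_
  have hlin : fderiv ℝ (revolution R Z) u v =
      v.1 • tangent (revolution R Z) 0 u + v.2 • tangent (revolution R Z) 1 u := by
    simp only [tangent]
    rw [← map_smul, ← map_smul, ← map_add]
    congr 1
    simp [dir]
  rw [hlin, revolution_tangent_zero hR hZ, revolution_tangent_one hR hZ hR' hZ'] at hv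
  have h0 := congrFun hv 0
  have h1 := congrFun hv 1
  have h2 := congrFun hv 2
  simp at h0 h1 h2
  have hv2 : v.2 = 0 := h2.resolve_right (hZne _)
  rw [hv2] at h0 h1
  have hv1 : v.1 = 0 := by
    have hsq := Real.sin_sq_add_cos_sq u.1
    have : v.1 * R u.2 = 0 := by
      linear_combination -Real.sin u.1 * h0 + Real.cos u.1 * h1 - (v.1 * R u.2) * hsq
    exact (mul_eq_zero.1 this).resolve_right (hRne _)
  exact Prod.ext hv1 hv2

/-- The second-order equation satisfied by the generating curve of a rotational translator says
that the mean curvature is the normal component of the position vector. Both sides are linear in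
the normal, which is a multiple of `(-Z' cos φ, -Z' sin φ, R')`. -/
theorem revolution_meanCurvature (hR : ContDiff ℝ ∞ R) (hZ : ContDiff ℝ ∞ Z)
    (hR' : ∀ t, HasDerivAt R (R' t) t) (hZ' : ∀ t, HasDerivAt Z (Z' t) t)
    (hR'' : ∀ t, HasDerivAt R' (R'' t) t) (hZ'' : ∀ t, HasDerivAt Z' (Z'' t) t)
    (hRpos : ∀ t, 0 < R t) (hZpos : ∀ t, 0 < Z t) (hZ'ne : ∀ t, Z' t ≠ 0)
    (hode : ∀ t, Z' t / R t + (R' t * Z'' t - Z' t * R'' t) / (R' t ^ 2 + Z' t ^ 2)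
      = -2 * R t * Z' t / Z t ^ 2)
    (u : ℝ × ℝ) (η : E3) (hη : IsUnitNormal (revolution R Z) u η) :
    hypMetric (revolution R Z u) (revolution R Z u) η = meanCurvature (revolution R Z) η u := by
  have hX := revolution_contDiff hR hZ
  have ht0 := funext (revolution_tangent_zero hR hZ)
  have ht1 := funext (revolution_tangent_one hR hZ hR' hZ')
  have hd00 : fderiv ℝ (tangent (revolution R Z) 0) u (dir 0) =
      ![-(R u.2 * Real.cos u.1), -(R u.2 * Real.sin u.1), 0] := by
    refine fderiv_dir_zero (tangent_differentiable hX 0 u) ?_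
    rw [ht0]
    refine (hasDerivAt_vec3 ((Real.hasDerivAt_sin u.1).const_mul (R u.2)).neg
      ((Real.hasDerivAt_cos u.1).const_mul (R u.2)) (hasDerivAt_const u.1 0)).congr_deriv ?_
    simp
  have hd11 : fderiv ℝ (tangent (revolution R Z) 1) u (dir 1) =
      ![R'' u.2 * Real.cos u.1, R'' u.2 * Real.sin u.1, Z'' u.2] := by
    refine fderiv_dir_one (tangent_differentiable hX 1 u) ?_
    rw [ht1]
    exact hasDerivAt_vec3 ((hR'' u.2).mul_const (Real.cos u.1))
      ((hR'' u.2).mul_const (Real.sin u.1)) (hZ'' u.2)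
  have hRp := hRpos u.2
  have hZp := hZpos u.2
  have hW : 0 < R' u.2 ^ 2 + Z' u.2 ^ 2 := by
    have := hZ'ne u.2
    positivity
  have hX2 : revolution R Z u 2 = Z u.2 := rfl
  have hI : firstForm (revolution R Z) u = Matrix.diagonal
      ![R u.2 ^ 2 / Z u.2 ^ 2, (R' u.2 ^ 2 + Z' u.2 ^ 2) / Z u.2 ^ 2] := by
    ext a b
    have hcs := Real.sin_sq_add_cos_sq u.1
    fin_cases a <;> fin_cases b <;>
      simp [firstForm, hypMetric, ht0, ht1, Fin.sum_univ_three, hX2]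
    · congr 1
      linear_combination R u.2 ^ 2 * hcs
    · left; ring
    · left; ring
    · congr 1
      linear_combination R' u.2 ^ 2 * hcs
  have hmem : revolution R Z u ∈ H3 := hZp
  obtain ⟨-, hη⟩ := hη
  have hη0 := hη 0
  have hη1 := hη 1
  rw [hypMetric, div_eq_zero_iff] at hη0 hη1
  have hη0 := hη0.resolve_right (by rw [hX2]; positivity)
  have hη1 := hη1.resolve_right (by rw [hX2]; positivity)
  rw [ht0] at hη0
  rw [ht1] at hη1
  simp [Fin.sum_univ_three] at hη0 hη1
  rw [meanCurvature, hI, trace_inv_diagonal_mul (by positivity) (by positivity)]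
  simp only [secondForm, Matrix.of_apply, hypMetric, covTangent, hd00, hd11,
    sum_christoffel hmem]
  rw [ht0, ht1]
  simp only [Fin.sum_univ_three, hX2]
  simp [revolution]
  have hode := hode u.2
  have hz' : Z' u.2 ≠ 0 := hZ'ne u.2
  clear hd00 hd11 ht0 ht1 hI hη hX2 hX hmem
  have hcs := Real.sin_sq_add_cos_sq u.1
  generalize Real.cos u.1 = c at *
  generalize Real.sin u.1 = s at *
  generalize η 0 = x at *
  generalize η 1 = y at *
  generalize η 2 = w at *
  generalize R u.2 = r at *
  generalize Z u.2 = z at *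
  generalize R' u.2 = r' at *
  generalize Z' u.2 = z' at *
  generalize R'' u.2 = r'' at *
  generalize Z'' u.2 = z'' at *
  obtain ⟨m, rfl, rfl⟩ : ∃ m, x = m * c ∧ y = m * s := by
    have h : x * s - y * c = 0 := by
      refine (mul_eq_zero.1 (?_ : r * (x * s - y * c) = 0)).resolve_left hRp.ne'
      linear_combination -hη0
    exact ⟨x * c + y * s, by linear_combination s * h - x * hcs,
      by linear_combination -c * h - y * hcs⟩
  have hw : w = -(m * r') / z' := by
    rw [eq_div_iff hz']
    linear_combination hη1 - m * r' * hcs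
  have hκ : r' * z'' - z' * r'' = (r' ^ 2 + z' ^ 2) * (-2 * r * z' / z ^ 2 - z' / r) := by
    rw [← hode]; field_simp; ring
  have e1 : r * c * (m * c) + r * s * (m * s) = r * m := by linear_combination r * m * hcs
  have e2 : -(r * c * (m * c)) + -(r * s * (m * s)) = -(r * m) := by
    linear_combination -(r * m) * hcs
  have e3 : r * s * (r * s) + r * c * (r * c) = r ^ 2 := by linear_combination r ^ 2 * hcs
  have e4 : r' * c * (r' * c) + r' * s * (r' * s) - z' * z' = r' ^ 2 - z' ^ 2 := by
    linear_combination r' ^ 2 * hcs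
  have e5 : (r'' * c + (-(z' * (r' * c)) + -(z' * (r' * c))) / z) * (m * c) +
      (r'' * s + (-(z' * (r' * s)) + -(z' * (r' * s))) / z) * (m * s) =
        (r'' - 2 * z' * r' / z) * m := by
    linear_combination ((r'' - 2 * z' * r' / z) * m) * hcs
  have e6 : (r'' - 2 * z' * r' / z) * m + (z'' + (r' ^ 2 - z' ^ 2) / z) * (-(m * r') / z') =
      (r' ^ 2 + z' ^ 2) * (m * (2 * r / z ^ 2 + 1 / r) - m * r' / (z * z')) := by
    have h : r'' = (r' * z'' - (r' ^ 2 + z' ^ 2) * (-2 * r * z' / z ^ 2 - z' / r)) / z' := by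
      rw [← hκ]; field_simp; ring
    rw [h]
    field_simp
    ring
  rw [e1, e2, e3, e4, e5, hw, e6]
  field_simp
  ring

end Revolution

/-! ### Estimates along the profile curve -/

theorem le_of_hasDerivAt_nonneg {f f' : ℝ → ℝ} (hf : ∀ t, HasDerivAt f (f' t) t)
    (hf' : ∀ t, 0 < t → 0 ≤ f' t) {t : ℝ} (ht : 0 ≤ t) : f 0 ≤ f t := by
  refine monotoneOn_of_deriv_nonneg (convex_Ici (0 : ℝ))
    (fun s _ => (hf s).continuousAt.continuousWithinAt)
    (fun s _ => (hf s).differentiableAt.differentiableWithinAt) (fun s hs => ?_)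
    self_mem_Ici ht ht
  rw [interior_Ici] at hs
  rw [(hf s).deriv]
  exact hf' s hs

theorem inv_cosh_le (t : ℝ) : (Real.cosh t)⁻¹ ≤ 2 * Real.exp (-t) := by
  have h1 := Real.exp_pos t
  have h2 := Real.exp_pos (-t)
  rw [inv_le_comm₀ (Real.cosh_pos t) (by positivity), mul_inv, Real.exp_neg, inv_inv, Real.cosh_eq]
  linarith

theorem hasDerivAt_tanh' (t : ℝ) : HasDerivAt Real.tanh (1 / Real.cosh t ^ 2) t := by
  have h : Real.tanh = fun t => Real.sinh t / Real.cosh t := funext Real.tanh_eq_sinh_div_cosh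
  rw [h]
  refine ((Real.hasDerivAt_sinh t).fun_div (Real.hasDerivAt_cosh t)
    (Real.cosh_pos t).ne').congr_deriv ?_
  congr 1
  linear_combination Real.cosh_sq t

theorem tanh_pos' {t : ℝ} (ht : 0 < t) : 0 < Real.tanh t := by
  rw [Real.tanh_eq_sinh_div_cosh]
  exact div_pos (Real.sinh_pos_iff.2 ht) (Real.cosh_pos t)

theorem speed_le {ρ z : ℝ} (hρ : 0 < ρ) (hz : 0 < z) : speed ρ z ≤ ρ := by
  unfold speed
  rw [div_le_iff₀ (by positivity)]
  nlinarith [mul_pos hρ (pow_pos hρ 2)]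

namespace IsProfile

variable {σ r : ℝ} {ρ z : ℝ → ℝ}

theorem sign_mul_self (h : IsProfile σ r ρ z) : σ * σ = 1 := by
  rcases h.sign with h | h <;> simp [h]

theorem radius_le (h : IsProfile σ r ρ z) {t : ℝ} (ht : 0 ≤ t) : r ≤ ρ t := by
  rw [← h.ρ_zero]
  exact le_of_hasDerivAt_nonneg h.deriv_ρ (fun s hs =>
    (mul_pos (speed_pos (h.ρ_pos s) (h.z_pos s)) (tanh_pos' hs)).le) ht

/-- Since `speed ρ z ≤ ρ`, the logarithmic derivative of `ρ` is at most `tanh t`. -/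
theorem ρ_le_cosh (h : IsProfile σ r ρ z) {t : ℝ} (ht : 0 ≤ t) : ρ t ≤ r * Real.cosh t := by
  have hd : ∀ t, HasDerivAt (fun t => -(ρ t / Real.cosh t))
      (Real.sinh t * (ρ t - speed (ρ t) (z t)) / Real.cosh t ^ 2) t := by
    intro t
    refine (((h.deriv_ρ t).fun_div (Real.hasDerivAt_cosh t)
      (Real.cosh_pos t).ne').fun_neg).congr_deriv ?_
    rw [Real.tanh_eq_sinh_div_cosh]
    have := (Real.cosh_pos t).ne'
    field_simp
    ring
  have := le_of_hasDerivAt_nonneg hd (fun s hs => by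
    have h1 := Real.sinh_pos_iff.2 hs
    have h2 := speed_le (h.ρ_pos s) (h.z_pos s)
    have h3 : 0 ≤ ρ s - speed (ρ s) (z s) := by linarith
    positivity) ht
  simp only [h.ρ_zero, Real.cosh_zero, div_one] at this
  rw [← div_le_iff₀ (Real.cosh_pos t)]
  linarith

theorem hasDerivAt_log_z (h : IsProfile σ r ρ z) (t : ℝ) :
    HasDerivAt (fun t => σ * Real.log (z t)) (speed (ρ t) (z t) / z t / Real.cosh t) t := by
  refine (((h.deriv_z t).log (h.z_pos t).ne').const_mul σ).congr_deriv ?_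
  have := (h.z_pos t).ne'
  have := (Real.cosh_pos t).ne'
  field_simp
  linear_combination speed (ρ t) (z t) * h.sign_mul_self

theorem abs_log_z (h : IsProfile σ r ρ z) {t : ℝ} (ht : 0 ≤ t) :
    |Real.log (z t)| = σ * Real.log (z t) := by
  have h0 := le_of_hasDerivAt_nonneg h.hasDerivAt_log_z (fun s _ => by
    have := speed_pos (h.ρ_pos s) (h.z_pos s)
    have := h.z_pos s
    have := Real.cosh_pos s
    positivity) ht
  simp only [h.z_zero, Real.log_one, mul_zero] at h0
  rcases h.sign with hs | hs <;> subst hs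
  · rw [abs_of_nonneg (by linarith)]; ring
  · rw [abs_of_nonpos (by linarith)]; ring

/-- An exponentially decaying bound for the logarithmic derivative of the height bounds the total
variation of the height. -/
theorem abs_log_z_le (h : IsProfile σ r ρ z) {c : ℝ}
    (hc : ∀ t, 0 < t → speed (ρ t) (z t) / z t / Real.cosh t ≤ c * Real.exp (-(t / 2)))
    {t : ℝ} (ht : 0 ≤ t) : |Real.log (z t)| ≤ 2 * c := by
  have hc0 : 0 ≤ c := by
    have h1 := hc 1 one_pos
    have : 0 ≤ speed (ρ 1) (z 1) / z 1 / Real.cosh 1 := by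
      have := speed_pos (h.ρ_pos 1) (h.z_pos 1)
      have := h.z_pos 1
      have := Real.cosh_pos 1
      positivity
    exact nonneg_of_mul_nonneg_left (this.trans h1) (Real.exp_pos _)
  have hd : ∀ t, HasDerivAt (fun t => -(2 * c * Real.exp (-(t / 2))) - σ * Real.log (z t))
      (c * Real.exp (-(t / 2)) - speed (ρ t) (z t) / z t / Real.cosh t) t := by
    intro t
    have h1 : HasDerivAt (fun t : ℝ => Real.exp (-(t / 2)))
        (Real.exp (-(t / 2)) * (-(1 / 2))) t := (((hasDerivAt_id' t).div_const 2).fun_neg).exp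
    refine ((h1.const_mul (2 * c)).fun_neg.fun_sub (h.hasDerivAt_log_z t)).congr_deriv ?_
    ring
  have := le_of_hasDerivAt_nonneg hd (fun s hs => sub_nonneg.2 (hc s hs)) ht
  simp only [h.z_zero, Real.log_one, mul_zero, zero_div, neg_zero, Real.exp_zero, mul_one] at this
  rw [h.abs_log_z ht]
  have := mul_nonneg hc0 (Real.exp_pos (-(t / 2))).le
  linarith

theorem abs_log_z_le_two (h : IsProfile σ r ρ z) {t : ℝ} (ht : 0 ≤ t) :
    |Real.log (z t)| ≤ 2 := by
  refine (h.abs_log_z_le (c := 1) (fun s hs => ?_) ht).trans (by norm_num)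
  have hρ := h.ρ_pos s
  have hz := h.z_pos s
  have h1 : speed (ρ s) (z s) / z s ≤ 1 / 2 := by
    unfold speed
    rw [div_div, div_le_div_iff₀ (by positivity) (by norm_num)]
    nlinarith [mul_nonneg hz.le (sq_nonneg (z s - ρ s)), mul_pos hz (pow_pos hρ 2)]
  have h2 : Real.exp (-s) ≤ Real.exp (-(s / 2)) := Real.exp_le_exp.2 (by linarith)
  have h3 := inv_cosh_le s
  have h4 := inv_pos.2 (Real.cosh_pos s)
  rw [div_eq_mul_inv _ (Real.cosh s)]
  calc _ ≤ 1 / 2 * (Real.cosh s)⁻¹ := mul_le_mul_of_nonneg_right h1 h4.le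
    _ ≤ _ := by linarith

theorem z_bounds (h : IsProfile σ r ρ z) {t : ℝ} (ht : 0 ≤ t) :
    Real.exp (-2) ≤ z t ∧ z t ≤ Real.exp 2 := by
  have h1 := abs_le.1 (h.abs_log_z_le_two ht)
  exact ⟨(Real.le_log_iff_exp_le (h.z_pos t)).1 h1.1, (Real.log_le_iff_le_exp (h.z_pos t)).1 h1.2⟩

/-- For a large neck the sheets are close to the horosphere at height `1`. -/
theorem abs_log_z_le_div (h : IsProfile σ r ρ z) {t : ℝ} (ht : 0 ≤ t) :
    |Real.log (z t)| ≤ 2 * (Real.exp 2 / r) := by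
  refine h.abs_log_z_le (fun s hs => ?_) ht
  have hρ := h.ρ_pos s
  have hz := h.z_pos s
  have hr := h.radius_pos
  have h1 : speed (ρ s) (z s) / z s ≤ Real.exp 2 / (2 * r) := by
    have e1 : speed (ρ s) (z s) / z s ≤ z s / (2 * ρ s) := by
      unfold speed
      rw [div_div, div_le_div_iff₀ (by positivity) (by positivity)]
      nlinarith [pow_pos hz 4]
    refine e1.trans (div_le_div₀ (Real.exp_pos _).le (h.z_bounds hs.le).2 (by positivity) ?_)
    linarith [h.radius_le hs.le]
  have h2 : Real.exp (-s) ≤ Real.exp (-(s / 2)) := Real.exp_le_exp.2 (by linarith)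
  have h3 := inv_cosh_le s
  have h4 := inv_pos.2 (Real.cosh_pos s)
  rw [div_eq_mul_inv _ (Real.cosh s)]
  calc _ ≤ Real.exp 2 / (2 * r) * (Real.cosh s)⁻¹ := mul_le_mul_of_nonneg_right h1 h4.le
    _ ≤ Real.exp 2 / (2 * r) * (2 * Real.exp (-(s / 2))) :=
      mul_le_mul_of_nonneg_left (by linarith) (by positivity)
    _ = _ := by field_simp

/-- For a small neck the sheets are close to the horosphere at height `1`: where `ρ` is small the
height varies slowly because of `y / (1 + 2 y ^ 2) ≤ √y`, `y = ρ / z`. -/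
theorem abs_log_z_le_sqrt (h : IsProfile σ r ρ z) {t : ℝ} (ht : 0 ≤ t) :
    |Real.log (z t)| ≤ 2 * √(2 * Real.exp 2 * r) := by
  refine h.abs_log_z_le (fun s hs => ?_) ht
  have hρ := h.ρ_pos s
  have hz := h.z_pos s
  have hr := h.radius_pos
  have hcosh := Real.cosh_pos s
  have e : Real.exp (-(s / 2)) = √(Real.exp (-s)) := by
    rw [← Real.exp_half]; congr 1; ring
  rw [e, ← Real.sqrt_mul (by positivity)]
  refine Real.le_sqrt_of_sq_le ?_
  -- with `y = ρ / z` this is `y / (1 + 2 * y ^ 2) ≤ √y`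
  have h1 : (speed (ρ s) (z s) / z s) ^ 2 ≤ ρ s / z s := by
    unfold speed
    rw [div_div, div_pow, div_le_div_iff₀ (by positivity) hz]
    have h2 : ρ s * z s ^ 3 ≤ (z s ^ 2 + 2 * ρ s ^ 2) ^ 2 := by
      nlinarith [sq_nonneg (z s - ρ s), mul_pos hρ hz, pow_pos hz 2, pow_pos hρ 2,
        mul_nonneg (pow_pos hz 2).le (sq_nonneg (z s - ρ s)), pow_pos hz 4, pow_pos hρ 4,
        mul_pos (pow_pos hz 2) (pow_pos hρ 2)]
    have h3 := mul_le_mul_of_nonneg_left h2 (by positivity : 0 ≤ ρ s * z s ^ 2)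
    nlinarith [h3]
  have h2 : ρ s / z s ≤ Real.exp 2 * (r * Real.cosh s) := by
    rw [div_le_iff₀ hz]
    have h3 := (h.z_bounds hs.le).1
    have h4 : 1 ≤ Real.exp 2 * z s := by
      have := mul_le_mul_of_nonneg_left h3 (Real.exp_pos 2).le
      rwa [← Real.exp_add, show (2 : ℝ) + -2 = 0 by norm_num, Real.exp_zero] at this
    have h5 := mul_le_mul_of_nonneg_left h4 (by positivity : 0 ≤ r * Real.cosh s)
    linarith [h.ρ_le_cosh hs.le]
  have h3 := inv_cosh_le s
  calc (speed (ρ s) (z s) / z s / Real.cosh s) ^ 2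
      = (speed (ρ s) (z s) / z s) ^ 2 / Real.cosh s ^ 2 := div_pow _ _ _
    _ ≤ Real.exp 2 * (r * Real.cosh s) / Real.cosh s ^ 2 :=
      div_le_div_of_nonneg_right (h1.trans h2) (by positivity)
    _ = Real.exp 2 * r * (Real.cosh s)⁻¹ := by field_simp
    _ ≤ Real.exp 2 * r * (2 * Real.exp (-s)) := mul_le_mul_of_nonneg_left h3 (by positivity)
    _ = _ := by ring

theorem hasDerivAt_ρ_sq (h : IsProfile σ r ρ z) (t : ℝ) :
    HasDerivAt (fun t => ρ t ^ 2) (2 * ρ t * speed (ρ t) (z t) * Real.tanh t) t := by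
  refine ((h.deriv_ρ t).fun_pow 2).congr_deriv ?_
  norm_num
  ring

theorem strictMonoOn_ρ_sq (h : IsProfile σ r ρ z) : StrictMonoOn (fun t => ρ t ^ 2) (Ici 0) := by
  refine strictMonoOn_of_deriv_pos (convex_Ici 0)
    (fun s _ => (h.hasDerivAt_ρ_sq s).continuousAt.continuousWithinAt) fun s hs => ?_
  rw [interior_Ici] at hs
  rw [(h.hasDerivAt_ρ_sq s).deriv]
  have := h.ρ_pos s
  have := speed_pos (h.ρ_pos s) (h.z_pos s)
  have := tanh_pos' hs
  positivity

/-- The squared distance from the axis grows at least linearly: `ρ * speed ρ z` is bounded below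
by a constant `k > 0`, so `ρ ^ 2 - 2 k log (cosh t)` increases. -/
theorem tendsto_ρ_sq (h : IsProfile σ r ρ z) : Tendsto (fun t => ρ t ^ 2) atTop atTop := by
  have hr := h.radius_pos
  set k : ℝ := (1 / r ^ 2 + 2 / Real.exp (-2) ^ 2)⁻¹ with hk
  have hkpos : 0 < k := by positivity
  have hd : ∀ t, HasDerivAt (fun t => ρ t ^ 2 - 2 * k * Real.log (Real.cosh t))
      (2 * (ρ t * speed (ρ t) (z t) - k) * Real.tanh t) t := by
    intro t
    refine ((h.hasDerivAt_ρ_sq t).fun_sub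
      (((Real.hasDerivAt_cosh t).log (Real.cosh_pos t).ne').const_mul (2 * k))).congr_deriv ?_
    rw [Real.tanh_eq_sinh_div_cosh]
    ring
  have hle : ∀ t, 0 ≤ t → 2 * k * (t - Real.log 2) ≤ ρ t ^ 2 := by
    intro t ht
    have h1 := le_of_hasDerivAt_nonneg hd (fun s hs => by
      have hρ := h.ρ_pos s
      have hz := h.z_pos s
      have e : ρ s * speed (ρ s) (z s) = (1 / ρ s ^ 2 + 2 / z s ^ 2)⁻¹ := by
        unfold speed; field_simp
      have h2 : k ≤ ρ s * speed (ρ s) (z s) := by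
        rw [e, hk]
        refine inv_anti₀ (by positivity) (add_le_add ?_ ?_)
        · exact one_div_le_one_div_of_le (by positivity)
            (pow_le_pow_left₀ hr.le (h.radius_le hs.le) 2)
        · exact div_le_div_of_nonneg_left (by norm_num) (by positivity)
            (pow_le_pow_left₀ (Real.exp_pos _).le (h.z_bounds hs.le).1 2)
      have := (tanh_pos' hs).le
      have : 0 ≤ ρ s * speed (ρ s) (z s) - k := by linarith
      positivity) ht
    simp only [h.ρ_zero, Real.cosh_zero, Real.log_one, mul_zero, sub_zero] at h1
    have h3 : t - Real.log 2 ≤ Real.log (Real.cosh t) := by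
      rw [Real.le_log_iff_exp_le (Real.cosh_pos t), Real.exp_sub, Real.exp_log (by norm_num),
        Real.cosh_eq]
      have := Real.exp_pos (-t)
      linarith
    have := mul_le_mul_of_nonneg_left h3 (by positivity : 0 ≤ 2 * k)
    nlinarith [sq_nonneg r]
  refine tendsto_atTop_mono' atTop ((eventually_ge_atTop 0).mono hle) ?_
  exact (tendsto_atTop_add_const_right _ _ tendsto_id).const_mul_atTop (by positivity)

end IsProfile

/-! ### The height as a function of the squared distance from the axis -/

/-- The parameter `t ≥ 0` at which the squared distance from the axis is `w`. It is meaningful for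
`w` at least the square of the radius of the neck, and arbitrary otherwise. -/
noncomputable def timeOf (ρ : ℝ → ℝ) (w : ℝ) : ℝ := Function.invFunOn (fun t => ρ t ^ 2) (Ici 0) w

/-- The height on the half `t ≥ 0` of the profile curve, as a function of `w = ρ ^ 2`. -/
noncomputable def heightOf (ρ z : ℝ → ℝ) (w : ℝ) : ℝ := z (timeOf ρ w)

/-- The derivative of `heightOf` with respect to `w`. -/
noncomputable def slopeOf (σ : ℝ) (ρ : ℝ → ℝ) (w : ℝ) : ℝ :=
  σ / (2 * ρ (timeOf ρ w) * Real.sinh (timeOf ρ w))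

/-- The height `g` as a function of `w` solves `g'' = g' * logSlopeRate w g g'`. -/
noncomputable def logSlopeRate (w g P : ℝ) : ℝ :=
  -(1 / w + 1 / g ^ 2 + 2 * P ^ 2 + 4 * w * P ^ 2 / g ^ 2)

namespace IsProfile

variable {σ r : ℝ} {ρ z : ℝ → ℝ}

theorem exists_time (h : IsProfile σ r ρ z) {w : ℝ} (hw : r ^ 2 ≤ w) :
    ∃ t ∈ Ici (0 : ℝ), ρ t ^ 2 = w := by
  obtain ⟨b, hb, hb0⟩ := ((h.tendsto_ρ_sq.eventually_ge_atTop w).and (eventually_ge_atTop 0)).exists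
  have hcont : ContinuousOn (fun t => ρ t ^ 2) (Icc 0 b) :=
    fun s _ => (h.hasDerivAt_ρ_sq s).continuousAt.continuousWithinAt
  obtain ⟨t, ht, hte⟩ := intermediate_value_Icc hb0 hcont ⟨by simpa [h.ρ_zero] using hw, hb⟩
  exact ⟨t, ht.1, hte⟩

theorem timeOf_nonneg (h : IsProfile σ r ρ z) {w : ℝ} (hw : r ^ 2 ≤ w) : 0 ≤ timeOf ρ w :=
  Function.invFunOn_mem (h.exists_time hw)

theorem ρ_timeOf_sq (h : IsProfile σ r ρ z) {w : ℝ} (hw : r ^ 2 ≤ w) : ρ (timeOf ρ w) ^ 2 = w :=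
  Function.invFunOn_eq (h.exists_time hw)

theorem radius_sq_le (h : IsProfile σ r ρ z) {t : ℝ} (ht : 0 ≤ t) : r ^ 2 ≤ ρ t ^ 2 :=
  pow_le_pow_left₀ h.radius_pos.le (h.radius_le ht) 2

theorem timeOf_sq (h : IsProfile σ r ρ z) {t : ℝ} (ht : 0 ≤ t) : timeOf ρ (ρ t ^ 2) = t :=
  h.strictMonoOn_ρ_sq.injOn (h.timeOf_nonneg (h.radius_sq_le ht)) ht
    (h.ρ_timeOf_sq (h.radius_sq_le ht))

theorem timeOf_radius (h : IsProfile σ r ρ z) : timeOf ρ (r ^ 2) = 0 := by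
  have := h.timeOf_sq le_rfl
  rwa [h.ρ_zero] at this

theorem timeOf_pos (h : IsProfile σ r ρ z) {w : ℝ} (hw : r ^ 2 < w) : 0 < timeOf ρ w := by
  refine lt_of_le_of_ne (h.timeOf_nonneg hw.le) fun h0 => ?_
  have := h.ρ_timeOf_sq hw.le
  rw [← h0, h.ρ_zero] at this
  exact hw.ne this

theorem timeOf_mono (h : IsProfile σ r ρ z) {w w' : ℝ} (hw : r ^ 2 ≤ w) (hww : w ≤ w') :
    timeOf ρ w ≤ timeOf ρ w' := by
  rw [← h.strictMonoOn_ρ_sq.le_iff_le (h.timeOf_nonneg hw) (h.timeOf_nonneg (hw.trans hww))]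
  simpa only [h.ρ_timeOf_sq hw, h.ρ_timeOf_sq (hw.trans hww)] using hww

theorem continuousOn_timeOf (h : IsProfile σ r ρ z) : ContinuousOn (timeOf ρ) (Ici (r ^ 2)) := by
  let T : ℝ → Ici (0 : ℝ) := fun w =>
    ⟨timeOf ρ (max w (r ^ 2)), h.timeOf_nonneg (le_max_right _ _)⟩
  have hmono : Monotone T := fun w w' hw =>
    h.timeOf_mono (le_max_right _ _) (max_le_max_right _ hw)
  have hsurj : Function.Surjective T := fun ⟨t, ht⟩ => by
    refine ⟨ρ t ^ 2, Subtype.ext ?_⟩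
    simp only [T]
    rw [max_eq_left (h.radius_sq_le ht), h.timeOf_sq ht]
  have hT : Continuous fun w => (T w : ℝ) :=
    continuous_subtype_val.comp (hmono.continuous_of_surjective hsurj)
  refine hT.continuousOn.congr fun w hw => ?_
  simp only [T]
  rw [max_eq_left hw]

theorem tendsto_timeOf (h : IsProfile σ r ρ z) : Tendsto (timeOf ρ) atTop atTop := by
  refine tendsto_atTop.2 fun b => ?_
  filter_upwards [eventually_ge_atTop (ρ (max b 0) ^ 2)] with w hw
  have h0 : 0 ≤ max b 0 := le_max_right _ _
  have := h.timeOf_mono (h.radius_sq_le h0) hw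
  rw [h.timeOf_sq h0] at this
  exact (le_max_left _ _).trans this

theorem hasDerivAt_timeOf (h : IsProfile σ r ρ z) {w : ℝ} (hw : r ^ 2 < w) :
    HasDerivAt (timeOf ρ) (2 * ρ (timeOf ρ w) * speed (ρ (timeOf ρ w)) (z (timeOf ρ w)) *
      Real.tanh (timeOf ρ w))⁻¹ w := by
  refine HasDerivAt.of_local_left_inverse
    (h.continuousOn_timeOf.continuousAt (Ici_mem_nhds hw)) (h.hasDerivAt_ρ_sq _) ?_ ?_
  · have := h.ρ_pos (timeOf ρ w)
    have := speed_pos (h.ρ_pos (timeOf ρ w)) (h.z_pos (timeOf ρ w))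
    have := tanh_pos' (h.timeOf_pos hw)
    positivity
  · filter_upwards [Ioi_mem_nhds hw] with y hy using h.ρ_timeOf_sq (le_of_lt hy)

theorem hasDerivAt_heightOf (h : IsProfile σ r ρ z) {w : ℝ} (hw : r ^ 2 < w) :
    HasDerivAt (heightOf ρ z) (slopeOf σ ρ w) w := by
  refine ((h.deriv_z (timeOf ρ w)).comp w (h.hasDerivAt_timeOf hw)).congr_deriv ?_
  have := h.ρ_pos (timeOf ρ w)
  have := speed_pos (h.ρ_pos (timeOf ρ w)) (h.z_pos (timeOf ρ w))
  have := Real.sinh_pos_iff.2 (h.timeOf_pos hw)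
  have := Real.cosh_pos (timeOf ρ w)
  rw [slopeOf, Real.tanh_eq_sinh_div_cosh]
  field_simp

theorem hasDerivAt_slopeOf (h : IsProfile σ r ρ z) {w : ℝ} (hw : r ^ 2 < w) :
    HasDerivAt (slopeOf σ ρ)
      (slopeOf σ ρ w * logSlopeRate w (heightOf ρ z w) (slopeOf σ ρ w)) w := by
  have hρ := h.ρ_pos (timeOf ρ w)
  have hz := h.z_pos (timeOf ρ w)
  have hs := Real.sinh_pos_iff.2 (h.timeOf_pos hw)
  have hc := Real.cosh_pos (timeOf ρ w)
  have h1 : HasDerivAt (fun t => σ / (2 * ρ t * Real.sinh t)) _ (timeOf ρ w) :=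
    (hasDerivAt_const _ σ).fun_div (((h.deriv_ρ (timeOf ρ w)).const_mul 2).fun_mul
      (Real.hasDerivAt_sinh _)) (by positivity)
  refine (h1.comp w (h.hasDerivAt_timeOf hw)).congr_deriv ?_
  have hw' := h.ρ_timeOf_sq hw.le
  have hσ := h.sign_mul_self
  have hcs := Real.cosh_sq (timeOf ρ w)
  rw [logSlopeRate, slopeOf, heightOf, Real.tanh_eq_sinh_div_cosh, speed]
  generalize timeOf ρ w = t at *
  subst hw'
  generalize Real.sinh t = s at *
  generalize Real.cosh t = c at *
  generalize ρ t = a at *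
  generalize z t = b at *
  field_simp
  rw [show σ ^ 2 = 1 by rw [sq, hσ], hcs]
  ring

theorem contDiffOn_timeOf (h : IsProfile σ r ρ z) :
    ContDiffOn ℝ ∞ (timeOf ρ) (Ioi (r ^ 2)) := by
  refine contDiffOn_infty.2 fun n => ?_
  induction n with
  | zero => exact contDiffOn_zero.2 (h.continuousOn_timeOf.mono Ioi_subset_Ici_self)
  | succ n ih =>
    refine (contDiffOn_succ_iff_deriv_of_isOpen (n := n) isOpen_Ioi).2
      ⟨fun w hw => (h.hasDerivAt_timeOf hw).differentiableAt.differentiableWithinAt, by simp, ?_⟩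
    have hρ : ContDiff ℝ n ρ := h.contDiff.1.of_le (by exact_mod_cast le_top)
    have hz : ContDiff ℝ n z := h.contDiff.2.of_le (by exact_mod_cast le_top)
    have e : ∀ w ∈ Ioi (r ^ 2), deriv (timeOf ρ) w =
        (2 * ρ (timeOf ρ w) * (ρ (timeOf ρ w) * z (timeOf ρ w) ^ 2 /
          (z (timeOf ρ w) ^ 2 + 2 * ρ (timeOf ρ w) ^ 2)) *
            (Real.sinh (timeOf ρ w) / Real.cosh (timeOf ρ w)))⁻¹ := fun w hw => by
      rw [(h.hasDerivAt_timeOf hw).deriv, speed, Real.tanh_eq_sinh_div_cosh]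
    have hρT := hρ.comp_contDiffOn ih
    have hzT := hz.comp_contDiffOn ih
    have hsT := (Real.contDiff_sinh (n := n)).comp_contDiffOn ih
    have hcT := (Real.contDiff_cosh (n := n)).comp_contDiffOn ih
    refine ContDiffOn.congr (ContDiffOn.inv (((contDiffOn_const.mul hρT).mul
      ((hρT.mul (hzT.pow 2)).div ((hzT.pow 2).add (contDiffOn_const.mul (hρT.pow 2)))
        fun w hw => ?_)).mul (hsT.div hcT fun w hw => (Real.cosh_pos _).ne')) fun w hw => ?_) e
    · have := h.ρ_pos (timeOf ρ w)
      have := h.z_pos (timeOf ρ w)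
      simp only [Function.comp]
      positivity
    · have := h.ρ_pos (timeOf ρ w)
      have := h.z_pos (timeOf ρ w)
      have := Real.sinh_pos_iff.2 (h.timeOf_pos hw)
      have := Real.cosh_pos (timeOf ρ w)
      simp only [Function.comp, Pi.div_apply]
      positivity

theorem contDiffOn_heightOf (h : IsProfile σ r ρ z) :
    ContDiffOn ℝ ∞ (heightOf ρ z) (Ioi (r ^ 2)) :=
  h.contDiff.2.comp_contDiffOn h.contDiffOn_timeOf

theorem continuousOn_heightOf (h : IsProfile σ r ρ z) :
    ContinuousOn (heightOf ρ z) (Ici (r ^ 2)) :=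
  h.contDiff.2.continuous.comp_continuousOn h.continuousOn_timeOf

end IsProfile

/-! ### The surface generated by a profile curve -/

/-- The surface of revolution generated by the curve `t ↦ (ρ t, z t)`. -/
def profileSurface (ρ z : ℝ → ℝ) : Set E3 := {p | ∃ t, p 0 ^ 2 + p 1 ^ 2 = ρ t ^ 2 ∧ p 2 = z t}

theorem exists_polar {x y R : ℝ} (hR : 0 < R) (h : x ^ 2 + y ^ 2 = R ^ 2) :
    ∃ θ, x = R * Real.cos θ ∧ y = R * Real.sin θ := by
  have hn : ‖(⟨x, y⟩ : ℂ)‖ = R := by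
    rw [Complex.norm_def, Complex.normSq_mk, ← sq, ← sq, h, Real.sqrt_sq hR.le]
  refine ⟨Complex.arg ⟨x, y⟩, ?_, ?_⟩
  · rw [← hn, Complex.norm_mul_cos_arg]
  · rw [← hn, Complex.norm_mul_sin_arg]

theorem revolution_range {ρ z : ℝ → ℝ} (hρ : ∀ t, 0 < ρ t) :
    range (revolution ρ z) = profileSurface ρ z := by
  ext p
  constructor
  · rintro ⟨u, rfl⟩
    refine ⟨u.2, ?_, rfl⟩
    simp only [revolution, Matrix.cons_val_zero, Matrix.cons_val_one]
    linear_combination ρ u.2 ^ 2 * Real.sin_sq_add_cos_sq u.1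
  · rintro ⟨t, h1, h2⟩
    obtain ⟨θ, h3, h4⟩ := exists_polar (hρ t) h1
    refine ⟨(θ, t), ?_⟩
    funext i
    fin_cases i <;> simp [revolution, h2, h3, h4]

theorem profileSurface_isRotational (ρ z : ℝ → ℝ) : IsRotational (profileSurface ρ z) := by
  have hsub : ∀ θ p, p ∈ profileSurface ρ z → rotZ θ p ∈ profileSurface ρ z := by
    rintro θ p ⟨t, h1, h2⟩
    refine ⟨t, ?_, h2⟩
    simp only [rotZ, Matrix.cons_val_zero, Matrix.cons_val_one]
    linear_combination h1 + (p 0 ^ 2 + p 1 ^ 2) * Real.sin_sq_add_cos_sq θ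
  intro θ
  refine Subset.antisymm (image_subset_iff.2 fun p hp => hsub θ p hp) fun p hp => ?_
  refine ⟨rotZ (-θ) p, hsub _ _ hp, ?_⟩
  have hcs := Real.sin_sq_add_cos_sq θ
  funext i
  fin_cases i <;> simp [rotZ]
  · linear_combination p 0 * hcs
  · linear_combination p 1 * hcs

namespace IsProfile

variable {σ r : ℝ} {ρ z : ℝ → ℝ}

theorem strictMono_z (h : IsProfile 1 r ρ z) : StrictMono z := by
  refine strictMono_of_deriv_pos fun t => ?_
  rw [(h.deriv_z t).deriv]
  have := speed_pos (h.ρ_pos t) (h.z_pos t)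
  have := Real.cosh_pos t
  positivity

theorem tendsto_ρ_sq_atBot (h : IsProfile σ r ρ z) : Tendsto (fun t => ρ t ^ 2) atBot atTop := by
  have := h.reverse.tendsto_ρ_sq.comp tendsto_neg_atBot_atTop
  simpa [Function.comp_def] using this

theorem radius_sq_le' (h : IsProfile σ r ρ z) (t : ℝ) : r ^ 2 ≤ ρ t ^ 2 := by
  rcases le_total 0 t with ht | ht
  · exact h.radius_sq_le ht
  · simpa using h.reverse.radius_sq_le (neg_nonneg.2 ht)

theorem ρ_sq_eq_iff (h : IsProfile σ r ρ z) (t : ℝ) : ρ t ^ 2 = r ^ 2 ↔ t = 0 := by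
  constructor
  · intro e
    rcases le_total 0 t with ht | ht
    · have := h.timeOf_sq ht
      rw [e, h.timeOf_radius] at this
      exact this.symm
    · have h1 := h.reverse.timeOf_sq (neg_nonneg.2 ht)
      simp only [neg_neg] at h1
      rw [e, h.reverse.timeOf_radius] at h1
      linarith
  · rintro rfl
    rw [h.ρ_zero]

/-- The moving surfaces `e^t • Σ` are generated by the curves `(e^t ρ, e^t z)`, and the second-order
equation is invariant under such dilations, so it is verified for all of them at once. -/
theorem isTranslator (h : IsProfile 1 r ρ z) : IsTranslator (revolution ρ z) := by
  obtain ⟨hρs, hzs⟩ := h.contDiff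
  have hX := revolution_contDiff hρs hzs
  have hscale : ∀ t, (fun u => Real.exp t • revolution ρ z u) =
      revolution (fun s => Real.exp t * ρ s) (fun s => Real.exp t * z s) := by
    intro t
    funext u i
    fin_cases i <;> simp [revolution, mul_assoc]
  let A : ℝ → ℝ := fun s => speed (ρ s) (z s)
  have hApos : ∀ s, 0 < A s := fun s => speed_pos (h.ρ_pos s) (h.z_pos s)
  have hAd : ∀ s, HasDerivAt A (deriv A s) s := fun s => by
    refine DifferentiableAt.hasDerivAt (DifferentiableAt.div ?_ ?_ ?_)
    · exact (h.deriv_ρ s).differentiableAt.mul ((h.deriv_z s).differentiableAt.pow 2)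
    · exact ((h.deriv_z s).differentiableAt.pow 2).add
        ((h.deriv_ρ s).differentiableAt.pow 2 |>.const_mul 2)
    · have := h.ρ_pos s
      have := h.z_pos s
      positivity
  have hR' : ∀ t s, HasDerivAt (fun s => Real.exp t * ρ s) (Real.exp t * (A s * Real.tanh s)) s :=
    fun t s => (h.deriv_ρ s).const_mul _
  have hZ' : ∀ t s, HasDerivAt (fun s => Real.exp t * z s) (Real.exp t * (A s / Real.cosh s)) s :=
    fun t s => ((h.deriv_z s).const_mul _).congr_deriv (by simp [A])
  have hR'' : ∀ t s, HasDerivAt (fun s => Real.exp t * (A s * Real.tanh s))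
      (Real.exp t * (deriv A s * Real.tanh s + A s * (1 / Real.cosh s ^ 2))) s := fun t s =>
    ((hAd s).fun_mul (hasDerivAt_tanh' s)).const_mul _
  have hZ'' : ∀ t s, HasDerivAt (fun s => Real.exp t * (A s / Real.cosh s))
      (Real.exp t * ((deriv A s * Real.cosh s - A s * Real.sinh s) / Real.cosh s ^ 2)) s :=
    fun t s => ((hAd s).fun_div (Real.hasDerivAt_cosh s) (Real.cosh_pos s).ne').const_mul _
  have hZne : ∀ t s, Real.exp t * (A s / Real.cosh s) ≠ 0 := fun t s => by
    have := hApos s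
    have := Real.cosh_pos s
    positivity
  refine ⟨?_, fun t u => ?_, fun t u => ?_, fun t u η hη => ?_⟩
  · exact (Real.contDiff_exp.comp contDiff_fst).smul (hX.comp contDiff_snd)
  · exact mul_pos (Real.exp_pos t) (h.z_pos u.2)
  · simp only [hscale]
    exact revolution_immersion (contDiff_const.mul hρs) (contDiff_const.mul hzs) (hR' t) (hZ' t)
      (fun s => (mul_pos (Real.exp_pos t) (h.ρ_pos s)).ne') (hZne t) u
  · have hd : deriv (fun τ => Real.exp τ • revolution ρ z u) t = Real.exp t • revolution ρ z u :=
      ((Real.hasDerivAt_exp t).smul_const _).deriv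
    rw [hd]
    have e := congrFun (hscale t) u
    simp only [hscale] at hη ⊢
    rw [e]
    refine revolution_meanCurvature (contDiff_const.mul hρs) (contDiff_const.mul hzs) (hR' t)
      (hZ' t) (hR'' t) (hZ'' t) (fun s => mul_pos (Real.exp_pos t) (h.ρ_pos s))
      (fun s => mul_pos (Real.exp_pos t) (h.z_pos s)) (hZne t) (fun s => ?_) u η hη
    have hρ := h.ρ_pos s
    have hz := h.z_pos s
    have hc := Real.cosh_pos s
    have hE := Real.exp_pos t
    have hA := hApos s
    have hcs := Real.cosh_sq s
    have hA' : A s * (z s ^ 2 + 2 * ρ s ^ 2) = ρ s * z s ^ 2 := by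
      simp only [A, speed]; field_simp
    have e1 : (Real.exp t * (A s * Real.tanh s)) ^ 2 + (Real.exp t * (A s / Real.cosh s)) ^ 2 =
        (Real.exp t * A s) ^ 2 := by
      rw [Real.tanh_eq_sinh_div_cosh]
      field_simp
      linear_combination -hcs
    have e2 : Real.exp t * (A s * Real.tanh s) *
        (Real.exp t * ((deriv A s * Real.cosh s - A s * Real.sinh s) / Real.cosh s ^ 2)) -
        Real.exp t * (A s / Real.cosh s) *
          (Real.exp t * (deriv A s * Real.tanh s + A s * (1 / Real.cosh s ^ 2))) =
        -((Real.exp t * A s) ^ 2 / Real.cosh s) := by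
      rw [Real.tanh_eq_sinh_div_cosh]
      field_simp
      linear_combination A s * hcs
    rw [e1, e2]
    field_simp
    linear_combination hA'

theorem isProperAnnulus (h : IsProfile 1 r ρ z) :
    IsProperAnnulus (revolution ρ z) (profileSurface ρ z) := by
  obtain ⟨hρs, hzs⟩ := h.contDiff
  refine ⟨revolution_contDiff hρs hzs, revolution_mem_H3 h.z_pos, ?_, fun u v => ?_,
    fun K hK _ => ?_, revolution_range h.ρ_pos⟩
  · refine revolution_immersion hρs hzs h.deriv_ρ h.deriv_z (fun t => (h.ρ_pos t).ne') fun t => ?_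
    have := speed_pos (h.ρ_pos t) (h.z_pos t)
    have := Real.cosh_pos t
    positivity
  · constructor
    · intro e
      have h2 : u.2 = v.2 := h.strictMono_z.injective (congrFun e 2)
      have h0 : ρ u.2 * Real.cos u.1 = ρ v.2 * Real.cos v.1 := congrFun e 0
      have h1 : ρ u.2 * Real.sin u.1 = ρ v.2 * Real.sin v.1 := congrFun e 1
      rw [h2] at h0 h1
      have h0 := mul_left_cancel₀ (h.ρ_pos v.2).ne' h0
      have h1 := mul_left_cancel₀ (h.ρ_pos v.2).ne' h1
      have := Real.Angle.cos_sin_inj h0.symm h1.symm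
      obtain ⟨k, hk⟩ := Real.Angle.angle_eq_iff_two_pi_dvd_sub.1 this
      exact ⟨h2, k, by linarith⟩
    · rintro ⟨h2, k, hk⟩
      simp only [revolution, h2, hk]
      rw [show u.1 + 2 * Real.pi * k = u.1 + k * (2 * Real.pi) by ring,
        Real.cos_add_int_mul_two_pi, Real.sin_add_int_mul_two_pi]
  · have hcont : Continuous fun p : E3 => p 0 ^ 2 + p 1 ^ 2 := by fun_prop
    obtain ⟨B, hB⟩ := (hK.image hcont).bddAbove
    obtain ⟨c₁, hc₁⟩ := eventually_atTop.1 (h.tendsto_ρ_sq.eventually_gt_atTop B)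
    obtain ⟨c₂, hc₂⟩ := eventually_atBot.1 (h.tendsto_ρ_sq_atBot.eventually_gt_atTop B)
    refine ⟨max c₁ (-c₂), fun u hu => ?_⟩
    have hle : ρ u.2 ^ 2 ≤ B := by
      have := hB (mem_image_of_mem _ hu)
      simp only [revolution, Matrix.cons_val_zero, Matrix.cons_val_one] at this
      nlinarith [Real.sin_sq_add_cos_sq u.1]
    rw [abs_le]
    constructor
    · by_contra! hlt
      exact (hc₂ u.2 (by linarith [le_max_right c₁ (-c₂)])).not_ge hle
    · by_contra! hlt
      exact (hc₁ u.2 (by linarith [le_max_left c₁ (-c₂)])).not_ge hle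

/-! ### The heights of the bounding horospheres -/

theorem bddAbove_z (h : IsProfile 1 r ρ z) : BddAbove (range z) := by
  refine ⟨Real.exp 2, ?_⟩
  rintro _ ⟨t, rfl⟩
  exact (h.strictMono_z.monotone (le_max_left t 0)).trans (h.z_bounds (le_max_right t 0)).2

theorem bddBelow_z (h : IsProfile 1 r ρ z) : BddBelow (range z) := by
  refine ⟨0, ?_⟩
  rintro _ ⟨t, rfl⟩
  exact (h.z_pos t).le

theorem tendsto_z_atTop (h : IsProfile 1 r ρ z) : Tendsto z atTop (𝓝 (⨆ t, z t)) :=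
  tendsto_atTop_ciSup h.strictMono_z.monotone h.bddAbove_z

theorem tendsto_z_atBot (h : IsProfile 1 r ρ z) : Tendsto z atBot (𝓝 (⨅ t, z t)) :=
  tendsto_atBot_ciInf h.strictMono_z.monotone h.bddBelow_z

theorem z_lt_iSup (h : IsProfile 1 r ρ z) (t : ℝ) : z t < ⨆ t, z t :=
  (h.strictMono_z (lt_add_one t)).trans_le (le_ciSup h.bddAbove_z (t + 1))

theorem iInf_lt_z (h : IsProfile 1 r ρ z) (t : ℝ) : ⨅ t, z t < z t :=
  (ciInf_le h.bddBelow_z (t - 1)).trans_lt (h.strictMono_z (sub_one_lt t))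

/-- A bound for the heights of both halves passes to the limit. -/
theorem heights_bound (h : IsProfile 1 r ρ z) {B : ℝ}
    (hB : ∀ t, |Real.log (z t)| ≤ B) :
    Real.exp (-B) ≤ ⨅ t, z t ∧ ⨆ t, z t ≤ Real.exp B := by
  have hb : ∀ t, Real.exp (-B) ≤ z t ∧ z t ≤ Real.exp B := fun t => by
    have h1 := abs_le.1 (hB t)
    exact ⟨(Real.le_log_iff_exp_le (h.z_pos t)).1 h1.1, (Real.log_le_iff_le_exp (h.z_pos t)).1 h1.2⟩
  exact ⟨le_ciInf fun t => (hb t).1, ciSup_le fun t => (hb t).2⟩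

theorem iInf_pos (h : IsProfile 1 r ρ z) : 0 < ⨅ t, z t := by
  refine (Real.exp_pos (-2)).trans_le (h.heights_bound (B := 2) fun t => ?_).1
  rcases le_total 0 t with ht | ht
  · exact h.abs_log_z_le_two ht
  · simpa using h.reverse.abs_log_z_le_two (neg_nonneg.2 ht)

theorem heights_bound_div (h : IsProfile 1 r ρ z) :
    Real.exp (-(2 * (Real.exp 2 / r))) ≤ ⨅ t, z t ∧ ⨆ t, z t ≤ Real.exp (2 * (Real.exp 2 / r)) := by
  refine h.heights_bound fun t => ?_
  rcases le_total 0 t with ht | ht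
  · exact h.abs_log_z_le_div ht
  · simpa using h.reverse.abs_log_z_le_div (neg_nonneg.2 ht)

theorem heights_bound_sqrt (h : IsProfile 1 r ρ z) :
    Real.exp (-(2 * √(2 * Real.exp 2 * r))) ≤ ⨅ t, z t ∧
      ⨆ t, z t ≤ Real.exp (2 * √(2 * Real.exp 2 * r)) := by
  refine h.heights_bound fun t => ?_
  rcases le_total 0 t with ht | ht
  · exact h.abs_log_z_le_sqrt ht
  · simpa using h.reverse.abs_log_z_le_sqrt (neg_nonneg.2 ht)

/-- Two points of the surface on a vertical line come from the two halves of the curve. -/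
theorem hasNeck (h : IsProfile 1 r ρ z) : HasNeck r (profileSurface ρ z) := by
  refine ⟨h.radius_pos, ⟨⨅ t, z t, ⨆ t, z t, h.iInf_pos, ?_⟩, fun B => ?_, fun p hp => ?_, ?_, ?_⟩
  · rintro p ⟨t, -, hp⟩
    rw [hp]
    exact ⟨(h.iInf_lt_z t).le, (h.z_lt_iSup t).le⟩
  · obtain ⟨t, ht⟩ := (h.tendsto_ρ_sq.eventually_gt_atTop (B ^ 2)).exists
    exact ⟨ρ t, lt_of_pow_lt_pow_left₀ 2 (h.ρ_pos t).le ht, z t, fun p h1 h2 => ⟨t, h1, h2⟩⟩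
  · constructor
    · rintro ⟨t, h1, h2⟩
      rw [hp, eq_comm, h.ρ_sq_eq_iff] at h1
      rw [h2, h1, h.z_zero]
    · intro h2
      exact ⟨0, by rw [hp, h.ρ_zero], by rw [h2, h.z_zero]⟩
  · rintro p ⟨t, h1, -⟩
    rw [h1]
    exact h.radius_sq_le' t
  · rintro p ⟨t, h1, h2⟩ hlt
    obtain ⟨t', ht', hne⟩ : ∃ t', ρ t' ^ 2 = ρ t ^ 2 ∧ t' ≠ t := by
      rw [h1] at hlt
      have ht0 : t ≠ 0 := fun ht => hlt.ne' ((h.ρ_sq_eq_iff t).2 ht)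
      rcases lt_or_gt_of_ne ht0 with ht | ht
      · obtain ⟨s, hs, hs'⟩ := h.exists_time hlt.le
        exact ⟨s, hs', fun e => by rw [e] at hs; exact absurd hs (not_le.2 ht)⟩
      · obtain ⟨s, hs, hs'⟩ := h.reverse.exists_time hlt.le
        exact ⟨-s, hs', fun e => by have : 0 ≤ s := hs; linarith⟩
    refine ⟨![p 0, p 1, z t'], ⟨t', by simp [h1, ht'], by simp⟩, fun e => ?_, by simp, by simp⟩
    have e2 := congrFun e 2
    simp only [Matrix.cons_val] at e2
    exact hne (h.strictMono_z.injective (e2.trans h2))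

end IsProfile

/-! ### Asymptotic boundary -/

/-- An unbounded set above some horosphere has no ideal points other than `∞`. -/
theorem asymptoticBoundary_eq {S : Set E3} {m : ℝ} (hm : 0 < m) (hS : ∀ p ∈ S, m ≤ p 2)
    (hunb : ¬ Bornology.IsBounded S) : asymptoticBoundary S = {OnePoint.infty} := by
  refine Subset.antisymm ?_ ?_
  · rintro x ⟨hx, hx' | ⟨p, hp, rfl⟩⟩
    · exact hx'
    · exfalso
      have h1 : p ∈ closure S := by
        rw [OnePoint.isOpenEmbedding_coe.isInducing.closure_eq_preimage_closure_image]
        exact hx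
      have h2 : closure S ⊆ {p | m ≤ p 2} :=
        closure_minimal hS (isClosed_le continuous_const (continuous_apply 2))
      have h3 : m ≤ p 2 := h2 h1
      have h4 : p 2 = 0 := hp
      linarith
  · rintro _ rfl
    refine ⟨?_, mem_insert _ _⟩
    by_contra hx
    have hopen : IsOpen (closure ((fun p : E3 => (p : OnePoint E3)) '' S))ᶜ :=
      isClosed_closure.isOpen_compl
    -- the complement of a neighbourhood of `∞` is compact
    have hc := (OnePoint.isOpen_iff_of_mem hx).1 hopen
    refine hunb (hc.2.isBounded.subset fun p hp => ?_)
    simp only [mem_compl_iff, mem_preimage, not_not]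
    exact subset_closure (mem_image_of_mem _ hp)

theorem HasNeck.asymptoticBoundary_eq {r : ℝ} {S : Set E3} (h : HasNeck r S) :
    asymptoticBoundary S = {OnePoint.infty} := by
  obtain ⟨m, M, hm, hM⟩ := h.slab
  refine HypTranslator.asymptoticBoundary_eq hm (fun p hp => (hM p hp).1) fun hb => ?_
  obtain ⟨B, hB⟩ := isBounded_iff_forall_norm_le.1 hb
  obtain ⟨R, hR, z, hz⟩ := h.large (max B 0)
  have h1 := hB _ (hz ![R, 0, z] (by simp) (by simp))
  have h2 := norm_le_pi_norm (![R, 0, z] : E3) 0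
  simp only [Matrix.cons_val_zero, Real.norm_eq_abs] at h2
  linarith [le_abs_self R, le_max_left B 0]

theorem asymptoticBoundary_horosphere : asymptoticBoundary (horosphere 1) = {OnePoint.infty} := by
  refine asymptoticBoundary_eq one_pos (fun p hp => (show p 2 = 1 from hp).ge) fun hb => ?_
  obtain ⟨B, hB⟩ := isBounded_iff_forall_norm_le.1 hb
  have h1 := hB ![B + 1, 0, 1] (by simp [horosphere])
  have h2 := norm_le_pi_norm (![B + 1, 0, 1] : E3) 0
  simp only [Matrix.cons_val_zero, Real.norm_eq_abs] at h2
  linarith [le_abs_self (B + 1)]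

/-! ### The two sheets -/

/-- The function whose vertical graph is the half `t ≥ 0` of the surface generated by the profile
curve. -/
noncomputable def sheet (ρ z : ℝ → ℝ) (q : ℝ × ℝ) : ℝ := heightOf ρ z (q.1 ^ 2 + q.2 ^ 2)

theorem isClosed_closedExterior (r : ℝ) : IsClosed (closedExterior r) :=
  isClosed_le continuous_const (by fun_prop)

theorem isOpen_openExterior (r : ℝ) : IsOpen (openExterior r) :=
  isOpen_lt continuous_const (by fun_prop)

/-- Every point outside the closed disk or on its boundary is a limit of points `(1 + ε) q`
outside the closed disk. -/
theorem closure_vGraph_openExterior {r : ℝ} (hr : 0 < r) {u : ℝ × ℝ → ℝ}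
    (hu : ContinuousOn u (closedExterior r)) :
    closure (vGraph (openExterior r) u) = vGraph (closedExterior r) u := by
  have hproj : Continuous fun p : E3 => (p 0, p 1) := by fun_prop
  refine Subset.antisymm ?_ ?_
  · refine closure_minimal (fun p hp => ⟨(show r ^ 2 < _ from hp.1).le, hp.2⟩) ?_
    have h1 : IsClosed {p : E3 | (p 0, p 1) ∈ closedExterior r} :=
      (isClosed_closedExterior r).preimage hproj
    have h2 : ContinuousOn (fun p : E3 => p 2 - u (p 0, p 1))
        {p : E3 | (p 0, p 1) ∈ closedExterior r} :=
      (continuous_apply 2).continuousOn.sub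
        (hu.comp hproj.continuousOn fun p hp => hp)
    have h3 := h2.preimage_isClosed_of_isClosed h1 (isClosed_singleton (x := (0 : ℝ)))
    convert h3 using 1
    ext p
    simp [vGraph, sub_eq_zero]
  · rintro p ⟨hp, hp2⟩
    have hp' : r ^ 2 ≤ p 0 ^ 2 + p 1 ^ 2 := hp
    let f : ℝ → ℝ × ℝ := fun s => ((1 + s) * p 0, (1 + s) * p 1)
    have hf : Tendsto f (𝓝[>] 0) (𝓝 (p 0, p 1)) := by
      have : Continuous f := by fun_prop
      have := this.tendsto 0
      simp only [f, add_zero, one_mul] at this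
      exact this.mono_left nhdsWithin_le_nhds
    have hfm : ∀ s > 0, f s ∈ openExterior r := fun s hs => by
      show r ^ 2 < ((1 + s) * p 0) ^ 2 + ((1 + s) * p 1) ^ 2
      have h1 : 0 < (2 * s + s ^ 2) * (p 0 ^ 2 + p 1 ^ 2) := by
        have : 0 < p 0 ^ 2 + p 1 ^ 2 := lt_of_lt_of_le (by positivity) hp'
        positivity
      nlinarith
    have hfm' : ∀ᶠ s in 𝓝[>] (0 : ℝ), f s ∈ openExterior r := by
      filter_upwards [self_mem_nhdsWithin] with s hs using hfm s hs
    have hlim : Tendsto (fun s => (![(f s).1, (f s).2, u (f s)] : E3)) (𝓝[>] 0) (𝓝 p) := by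
      have hu' : Tendsto (fun s => u (f s)) (𝓝[>] 0) (𝓝 (p 2)) := by
        rw [hp2]
        exact (hu _ hp).tendsto.comp (tendsto_nhdsWithin_iff.2
          ⟨hf, hfm'.mono fun s (hs : r ^ 2 < _) => le_of_lt hs⟩)
      refine tendsto_pi_nhds.2 fun i => ?_
      fin_cases i
      · exact (continuous_fst.tendsto _).comp hf
      · exact (continuous_snd.tendsto _).comp hf
      · exact hu'
    exact mem_closure_of_tendsto hlim (hfm'.mono fun s hs => ⟨hs, rfl⟩)

theorem closure_vGraph_diff {r : ℝ} (hr : 0 < r) {u : ℝ × ℝ → ℝ}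
    (hu : ContinuousOn u (closedExterior r))
    (hu1 : ∀ q : ℝ × ℝ, q.1 ^ 2 + q.2 ^ 2 = r ^ 2 → u q = 1) :
    closure (vGraph (openExterior r) u) \ vGraph (openExterior r) u = neckCircle r := by
  rw [closure_vGraph_openExterior hr hu]
  ext p
  constructor
  · rintro ⟨⟨h1, h2⟩, h3⟩
    have h4 : p 0 ^ 2 + p 1 ^ 2 = r ^ 2 := by
      refine le_antisymm (le_of_not_gt fun h4 => h3 ⟨h4, h2⟩) h1
    exact ⟨h4, by rw [h2, hu1 _ h4]⟩
  · rintro ⟨h1, h2⟩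
    refine ⟨⟨?_, by rw [h2, hu1 _ h1]⟩, fun h3 => ?_⟩
    · exact h1.ge
    · have h4 : r ^ 2 < p 0 ^ 2 + p 1 ^ 2 := h3.1
      exact h4.ne' h1

namespace IsProfile

variable {σ r : ℝ} {ρ z : ℝ → ℝ}

theorem mem_vGraph_sheet (h : IsProfile σ r ρ z) (p : E3) :
    p ∈ vGraph (closedExterior r) (sheet ρ z) ↔
      ∃ t, 0 ≤ t ∧ p 0 ^ 2 + p 1 ^ 2 = ρ t ^ 2 ∧ p 2 = z t := by
  constructor
  · rintro ⟨h1, h2⟩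
    have h1 : r ^ 2 ≤ p 0 ^ 2 + p 1 ^ 2 := h1
    exact ⟨timeOf ρ (p 0 ^ 2 + p 1 ^ 2), h.timeOf_nonneg h1, (h.ρ_timeOf_sq h1).symm, h2⟩
  · rintro ⟨t, ht, h1, h2⟩
    refine ⟨?_, ?_⟩
    · show r ^ 2 ≤ p 0 ^ 2 + p 1 ^ 2
      rw [h1]
      exact h.radius_sq_le ht
    · simp only [sheet, heightOf]
      rw [h1, h.timeOf_sq ht, h2]

theorem profileSurface_eq (h : IsProfile σ r ρ z) :
    profileSurface ρ z =
      vGraph (closedExterior r) (sheet (fun t => ρ (-t)) (fun t => z (-t))) ∪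
        vGraph (closedExterior r) (sheet ρ z) := by
  ext p
  rw [mem_union, h.mem_vGraph_sheet, h.reverse.mem_vGraph_sheet]
  constructor
  · rintro ⟨t, h1, h2⟩
    rcases le_total 0 t with ht | ht
    · exact .inr ⟨t, ht, h1, h2⟩
    · exact .inl ⟨-t, by linarith, by simpa using h1, by simpa using h2⟩
  · rintro (⟨t, -, h1, h2⟩ | ⟨t, -, h1, h2⟩)
    exacts [⟨-t, h1, h2⟩, ⟨t, h1, h2⟩]

theorem continuousOn_sheet (h : IsProfile σ r ρ z) :
    ContinuousOn (sheet ρ z) (closedExterior r) :=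
  h.continuousOn_heightOf.comp (f := fun q : ℝ × ℝ => q.1 ^ 2 + q.2 ^ 2) (by fun_prop)
    fun q hq => hq

theorem contDiffOn_sheet (h : IsProfile σ r ρ z) :
    ContDiffOn ℝ ∞ (sheet ρ z) (openExterior r) :=
  h.contDiffOn_heightOf.comp (f := fun q : ℝ × ℝ => q.1 ^ 2 + q.2 ^ 2)
    (by fun_prop) fun q hq => hq

theorem sheet_eq_one (h : IsProfile σ r ρ z) (q : ℝ × ℝ) (hq : q.1 ^ 2 + q.2 ^ 2 = r ^ 2) :
    sheet ρ z q = 1 := by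
  rw [sheet, heightOf, hq, h.timeOf_radius, h.z_zero]

theorem tendsto_sheet (h : IsProfile σ r ρ z) {l : ℝ} (hl : Tendsto z atTop (𝓝 l)) :
    Tendsto (sheet ρ z) (Bornology.cobounded (ℝ × ℝ)) (𝓝 l) := by
  have h1 : Tendsto (fun q : ℝ × ℝ => q.1 ^ 2 + q.2 ^ 2) (Bornology.cobounded (ℝ × ℝ)) atTop := by
    refine tendsto_atTop_mono (fun q => ?_)
      ((tendsto_pow_atTop two_ne_zero).comp (tendsto_norm_cobounded_atTop (E := ℝ × ℝ)))
    simp only [Function.comp, Prod.norm_def, Real.norm_eq_abs]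
    rcases max_choice |q.1| |q.2| with e | e <;> rw [e, sq_abs] <;>
      nlinarith [sq_nonneg q.1, sq_nonneg q.2]
  exact (hl.comp h.tendsto_timeOf).comp h1

end IsProfile

/-! ### Convergence of the sheets as the neck shrinks -/

/-- The height `g` as a function of `w` solves `g''' = g' * secondRate w g g'`. -/
noncomputable def secondRate (w g P : ℝ) : ℝ :=
  logSlopeRate w g P ^ 2 + (1 / w ^ 2 + 2 * P / g ^ 3 - 4 * P ^ 2 * logSlopeRate w g P
    - 4 * P ^ 2 / g ^ 2 - 8 * w * P ^ 2 * logSlopeRate w g P / g ^ 2 + 8 * w * P ^ 3 / g ^ 3)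

theorem rates_bounded {a b : ℝ} (ha : 0 < a) : ∃ M, 1 ≤ M ∧ ∀ w ∈ Icc a b,
    ∀ g ∈ Icc (1 / 2 : ℝ) 2, ∀ P ∈ Icc (-1 : ℝ) 1,
      |logSlopeRate w g P| ≤ M ∧ |secondRate w g P| ≤ M := by
  let K : Set (ℝ × ℝ × ℝ) := Icc a b ×ˢ Icc (1 / 2 : ℝ) 2 ×ˢ Icc (-1 : ℝ) 1
  have hK : IsCompact K := isCompact_Icc.prod (isCompact_Icc.prod isCompact_Icc)
  have hw : ∀ p ∈ K, p.1 ≠ 0 := fun p hp => (ha.trans_le hp.1.1).ne'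
  have hg : ∀ p ∈ K, p.2.1 ≠ 0 := fun p hp =>
    (lt_of_lt_of_le (by norm_num) hp.2.1.1 : (0 : ℝ) < p.2.1).ne'
  have h3 : ∀ p ∈ K, p.1 ^ 2 ≠ 0 := fun p hp => pow_ne_zero _ (hw p hp)
  have h4 : ∀ p ∈ K, p.2.1 ^ 2 ≠ 0 := fun p hp => pow_ne_zero _ (hg p hp)
  have h5 : ∀ p ∈ K, p.2.1 ^ 3 ≠ 0 := fun p hp => pow_ne_zero _ (hg p hp)
  have h1 : ContinuousOn (fun p : ℝ × ℝ × ℝ => logSlopeRate p.1 p.2.1 p.2.2) K := by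
    unfold logSlopeRate
    fun_prop (disch := assumption)
  have h2 : ContinuousOn (fun p : ℝ × ℝ × ℝ => secondRate p.1 p.2.1 p.2.2) K := by
    unfold secondRate
    fun_prop (disch := assumption)
  obtain ⟨M₁, hM₁⟩ := hK.exists_bound_of_continuousOn h1
  obtain ⟨M₂, hM₂⟩ := hK.exists_bound_of_continuousOn h2
  refine ⟨max 1 (max M₁ M₂), le_max_left _ _, fun w hw g hg P hP => ⟨?_, ?_⟩⟩
  · exact (hM₁ (w, g, P) ⟨hw, hg, hP⟩).trans ((le_max_left _ _).trans (le_max_right _ _))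
  · exact (hM₂ (w, g, P) ⟨hw, hg, hP⟩).trans ((le_max_right _ _).trans (le_max_right _ _))

theorem tendsto_exp_sqrt_radius :
    Tendsto (fun r : ℝ => Real.exp (2 * √(2 * Real.exp 2 * r))) (𝓝[>] 0) (𝓝 1) := by
  have : Continuous fun r : ℝ => Real.exp (2 * √(2 * Real.exp 2 * r)) := by fun_prop
  have := (this.tendsto 0).mono_left (nhdsWithin_le_nhds (s := Ioi 0))
  simpa using this

namespace IsProfile

variable {σ r : ℝ} {ρ z : ℝ → ℝ}

theorem hasDerivAt_slope_mul_rate (h : IsProfile σ r ρ z) {w : ℝ} (hw : r ^ 2 < w) :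
    HasDerivAt (fun w => slopeOf σ ρ w * logSlopeRate w (heightOf ρ z w) (slopeOf σ ρ w))
      (slopeOf σ ρ w * secondRate w (heightOf ρ z w) (slopeOf σ ρ w)) w := by
  have hP := h.hasDerivAt_slopeOf hw
  have hg := h.hasDerivAt_heightOf hw
  have hgpos : 0 < heightOf ρ z w := h.z_pos _
  have hwpos : 0 < w := lt_trans (pow_pos h.radius_pos 2) hw
  have h1 : HasDerivAt (fun w => logSlopeRate w (heightOf ρ z w) (slopeOf σ ρ w)) _ w :=
    (((((hasDerivAt_const w (1 : ℝ)).fun_div (hasDerivAt_id' w) hwpos.ne').fun_add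
      ((hasDerivAt_const w (1 : ℝ)).fun_div (hg.fun_pow 2) (by positivity))).fun_add
      ((hP.fun_pow 2).const_mul 2)).fun_add
      ((((hasDerivAt_id' w).const_mul 4).fun_mul (hP.fun_pow 2)).fun_div (hg.fun_pow 2)
        (by positivity))).fun_neg
  refine (hP.fun_mul h1).congr_deriv ?_
  generalize slopeOf σ ρ w = P at *
  generalize heightOf ρ z w = g at *
  simp only [secondRate]
  generalize logSlopeRate w g P = Ψ at *
  norm_num
  field_simp
  ring

/-- Off the neck the slope of the sheets is of the order of the radius of the neck. -/
theorem abs_slopeOf_le (h : IsProfile σ r ρ z) {a w : ℝ} (ha : 0 < a) (hr : r ^ 2 ≤ a / 2)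
    (hw : a ≤ w) : |slopeOf σ ρ w| ≤ r / a := by
  have hrw : r ^ 2 < w := by linarith
  have hr0 := h.radius_pos
  have hs := Real.sinh_pos_iff.2 (h.timeOf_pos hrw)
  have hρ := h.ρ_pos (timeOf ρ w)
  have h1 := h.ρ_timeOf_sq hrw.le
  have h2 : w ≤ r ^ 2 * Real.cosh (timeOf ρ w) ^ 2 := by
    rw [← mul_pow]
    exact h1.symm.le.trans (pow_le_pow_left₀ hρ.le (h.ρ_le_cosh (h.timeOf_nonneg hrw.le)) 2)
  rw [Real.cosh_sq] at h2
  have hσ : |σ| = 1 := by rcases h.sign with e | e <;> simp [e]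
  rw [slopeOf, abs_div, hσ, abs_of_pos (by positivity), div_le_div_iff₀ (by positivity) ha,
    one_mul]
  refine le_of_sq_le_sq ?_ (by positivity)
  have h3 : (r * (2 * ρ (timeOf ρ w) * Real.sinh (timeOf ρ w))) ^ 2 =
      4 * w * (r ^ 2 * Real.sinh (timeOf ρ w) ^ 2) := by
    linear_combination (4 * r ^ 2 * Real.sinh (timeOf ρ w) ^ 2) * h1
  have h4 : a / 2 ≤ r ^ 2 * Real.sinh (timeOf ρ w) ^ 2 := by linarith
  rw [h3]
  nlinarith [mul_le_mul hw h4 (by linarith) (by linarith)]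

theorem abs_heightOf_sub_one_le (h : IsProfile σ r ρ z) {w : ℝ} (hw : r ^ 2 ≤ w) :
    |heightOf ρ z w - 1| ≤ Real.exp (2 * √(2 * Real.exp 2 * r)) - 1 := by
  set B := 2 * √(2 * Real.exp 2 * r)
  have h1 := abs_le.1 (h.abs_log_z_le_sqrt (h.timeOf_nonneg hw))
  have hz := h.z_pos (timeOf ρ w)
  have h2 : z (timeOf ρ w) ≤ Real.exp B := (Real.log_le_iff_le_exp hz).1 h1.2
  have h3 : Real.exp (-B) ≤ z (timeOf ρ w) := (Real.le_log_iff_exp_le hz).1 h1.1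
  have h4 : 2 ≤ Real.exp B + Real.exp (-B) := by
    have := Real.one_le_cosh B
    rw [Real.cosh_eq] at this
    linarith
  rw [heightOf, abs_le]
  constructor <;> linarith

theorem norm_iteratedFDerivWithin_heightOf (h : IsProfile σ r ρ z) {w ε : ℝ} (hw : r ^ 2 < w)
    (h0 : |heightOf ρ z w - 1| ≤ ε) (h1 : |slopeOf σ ρ w| ≤ ε)
    (h2 : |slopeOf σ ρ w * logSlopeRate w (heightOf ρ z w) (slopeOf σ ρ w)| ≤ ε)
    (h3 : |slopeOf σ ρ w * secondRate w (heightOf ρ z w) (slopeOf σ ρ w)| ≤ ε)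
    {i : ℕ} (hi : i ≤ 3) :
    ‖iteratedFDerivWithin ℝ i (fun w => heightOf ρ z w - 1) (Ioi (r ^ 2)) w‖ ≤ ε := by
  have hU : UniqueDiffOn ℝ (Ioi (r ^ 2)) := isOpen_Ioi.uniqueDiffOn
  have step : ∀ {f f' : ℝ → ℝ} {n : ℕ}, EqOn (iteratedDerivWithin n
      (fun w => heightOf ρ z w - 1) (Ioi (r ^ 2))) f (Ioi (r ^ 2)) →
      (∀ w ∈ Ioi (r ^ 2), HasDerivAt f (f' w) w) → EqOn (iteratedDerivWithin (n + 1)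
      (fun w => heightOf ρ z w - 1) (Ioi (r ^ 2))) f' (Ioi (r ^ 2)) := by
    intro f f' n hE hd x hx
    rw [iteratedDerivWithin_succ, derivWithin_congr hE (hE hx)]
    exact (hd x hx).hasDerivWithinAt.derivWithin (hU x hx)
  have e0 : EqOn (iteratedDerivWithin 0 (fun w => heightOf ρ z w - 1) (Ioi (r ^ 2)))
      (fun w => heightOf ρ z w - 1) (Ioi (r ^ 2)) := fun x _ => by rw [iteratedDerivWithin_zero]
  have e1 := step e0 fun x hx => (h.hasDerivAt_heightOf hx).sub_const 1
  have e2 := step e1 fun x hx => h.hasDerivAt_slopeOf hx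
  have e3 := step e2 fun x hx => h.hasDerivAt_slope_mul_rate hx
  rw [norm_iteratedFDerivWithin_eq_norm_iteratedDerivWithin]
  interval_cases i
  · rw [e0 hw]; exact h0
  · rw [e1 hw]; exact h1
  · rw [e2 hw]; exact h2
  · rw [e3 hw]; exact h3

end IsProfile

/-- Off the axis the height functions converge to `1` with three derivatives. -/
theorem eventually_heightOf_small {a b : ℝ} (ha : 0 < a) {ε : ℝ} (hε : 0 < ε) :
    ∀ᶠ r in 𝓝[>] (0 : ℝ), ∀ σ ρ z, IsProfile σ r ρ z → ∀ w ∈ Icc a b, r ^ 2 < w ∧ ∀ i ≤ 3,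
      ‖iteratedFDerivWithin ℝ i (fun w => heightOf ρ z w - 1) (Ioi (r ^ 2)) w‖ ≤ ε := by
  obtain ⟨M, hM1, hM⟩ := rates_bounded (b := b) ha
  have hM0 : 0 < M := by linarith
  have t1 : ∀ᶠ r : ℝ in 𝓝[>] 0, r ^ 2 < a / 2 := by
    have : Tendsto (fun r : ℝ => r ^ 2) (𝓝[>] 0) (𝓝 0) := by
      have := ((continuous_pow 2).tendsto (0 : ℝ)).mono_left (nhdsWithin_le_nhds (s := Ioi 0))
      simpa using this
    exact this.eventually_lt_const (by positivity)
  have t2 : ∀ᶠ r : ℝ in 𝓝[>] 0, r / a < min 1 (ε / M) := by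
    have : Tendsto (fun r : ℝ => r / a) (𝓝[>] 0) (𝓝 0) := by
      have := ((continuous_id.div_const a).tendsto (0 : ℝ)).mono_left
        (nhdsWithin_le_nhds (s := Ioi 0))
      simpa using this
    exact this.eventually_lt_const (by positivity)
  have t3 : ∀ᶠ r : ℝ in 𝓝[>] 0,
      Real.exp (2 * √(2 * Real.exp 2 * r)) < 1 + min (1 / 2) ε :=
    tendsto_exp_sqrt_radius.eventually_lt_const
      (lt_add_of_pos_right 1 (lt_min (by norm_num) hε))
  filter_upwards [t1, t2, t3] with r h1 h2 h3 σ ρ z h w hw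
  have hrw : r ^ 2 < w := by linarith [hw.1]
  have hP := h.abs_slopeOf_le ha h1.le hw.1
  have hP1 : |slopeOf σ ρ w| ≤ 1 := hP.trans (h2.le.trans (min_le_left _ _))
  have hPε : |slopeOf σ ρ w| ≤ ε / M := hP.trans (h2.le.trans (min_le_right _ _))
  have hg := h.abs_heightOf_sub_one_le hrw.le
  have hg2 : |heightOf ρ z w - 1| ≤ 1 / 2 := by linarith [min_le_left (1 / 2) ε]
  have hgε : |heightOf ρ z w - 1| ≤ ε := by linarith [min_le_right (1 / 2) ε]
  obtain ⟨hr1, hr2⟩ := hM w hw (heightOf ρ z w)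
    (by have := abs_le.1 hg2; constructor <;> linarith) _ (abs_le.1 hP1)
  have hmul : ∀ x : ℝ, |x| ≤ M → |slopeOf σ ρ w * x| ≤ ε := fun x hx => by
    rw [abs_mul]
    calc _ ≤ ε / M * M := mul_le_mul hPε hx (abs_nonneg _) (by positivity)
      _ = ε := by field_simp
  refine ⟨hrw, fun i hi => h.norm_iteratedFDerivWithin_heightOf hrw hgε ?_ (hmul _ hr1)
    (hmul _ hr2) hi⟩
  exact hPε.trans (div_le_self hε.le hM1)

/-- On compact sets off the axis the sheets converge to the horosphere at height `1` with three
derivatives. -/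
theorem eventually_sheet_small {A : Set (ℝ × ℝ)} (hA : IsCompact A) (h0 : (0, 0) ∉ A) {ε : ℝ}
    (hε : 0 < ε) : ∀ᶠ r in 𝓝[>] (0 : ℝ), ∀ σ ρ z, IsProfile σ r ρ z → ∀ q ∈ A,
      q ∈ openExterior r ∧ ∀ k ≤ 3, ‖iteratedFDeriv ℝ k (fun q => sheet ρ z q - 1) q‖ ≤ ε := by
  let f : ℝ × ℝ → ℝ := fun q => q.1 ^ 2 + q.2 ^ 2
  have hf : ContDiff ℝ ∞ f := by fun_prop
  obtain ⟨a, ha, b, hab⟩ : ∃ a > 0, ∃ b, ∀ q ∈ A, f q ∈ Icc a b := by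
    rcases A.eq_empty_or_nonempty with rfl | hne
    · exact ⟨1, one_pos, 1, by simp⟩
    · obtain ⟨q₀, hq₀, hmin⟩ := hA.exists_isMinOn hne hf.continuous.continuousOn
      obtain ⟨q₁, hq₁, hmax⟩ := hA.exists_isMaxOn hne hf.continuous.continuousOn
      refine ⟨f q₀, ?_, f q₁, fun q hq => ⟨hmin hq, hmax hq⟩⟩
      have hne0 : q₀ ≠ (0, 0) := fun e => h0 (e ▸ hq₀)
      by_contra hle
      simp only [f, not_lt] at hle
      exact hne0 (Prod.ext (by nlinarith [sq_nonneg q₀.1, sq_nonneg q₀.2])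
        (by nlinarith [sq_nonneg q₀.1, sq_nonneg q₀.2]))
  obtain ⟨D, hD1, hD⟩ : ∃ D, 1 ≤ D ∧ ∀ q ∈ A, ∀ i ≤ 3, ‖iteratedFDeriv ℝ i f q‖ ≤ D := by
    have hb : ∀ i : ℕ, ∃ D, ∀ q ∈ A, ‖iteratedFDeriv ℝ i f q‖ ≤ D := fun i =>
      hA.exists_bound_of_continuousOn
        (hf.continuous_iteratedFDeriv (by exact_mod_cast le_top)).continuousOn
    choose D hD using hb
    refine ⟨max 1 (max (max (D 0) (D 1)) (max (D 2) (D 3))), le_max_left _ _, fun q hq i hi => ?_⟩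
    refine (hD i q hq).trans (le_trans ?_ (le_max_right _ _))
    interval_cases i <;> simp
  have hε' : 0 < ε / (6 * D ^ 3) := by positivity
  filter_upwards [eventually_heightOf_small (b := b) ha hε'] with r hr σ ρ z h q hq
  obtain ⟨hq1, hq2⟩ := hr σ ρ z h (f q) (hab q hq)
  refine ⟨hq1, fun k hk => ?_⟩
  have hcomp := norm_iteratedFDerivWithin_comp_le (n := k) (N := ∞) (x := q)
    (h.contDiffOn_heightOf.sub contDiffOn_const) (hf.contDiffOn (s := openExterior r))
    (by exact_mod_cast le_top) isOpen_Ioi.uniqueDiffOn (isOpen_openExterior r).uniqueDiffOn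
    (fun q hq => hq) hq1 (fun i hi => hq2 i (hi.trans hk)) (D := D) (fun i hi1 hi => by
      rw [iteratedFDerivWithin_of_isOpen i (isOpen_openExterior r) hq1]
      exact (hD q hq i (hi.trans hk)).trans (le_self_pow₀ hD1 (by lia)))
  rw [iteratedFDerivWithin_of_isOpen k (isOpen_openExterior r) hq1] at hcomp
  refine hcomp.trans ?_
  have hfac : (k.factorial : ℝ) ≤ 6 := by
    have : k.factorial ≤ Nat.factorial 3 := Nat.factorial_le hk
    exact_mod_cast this
  have hpow : D ^ k ≤ D ^ 3 := pow_le_pow_right₀ hD1 hk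
  calc _ ≤ 6 * (ε / (6 * D ^ 3)) * D ^ 3 := by gcongr
    _ = ε := by field_simp

/-- A bound for the `C^{2,α}` norm by the first three derivatives on a thickening: nearby points
are handled by the mean value inequality, distant ones by the bound for the second derivative. -/
theorem c2HolderNorm_le {α : ℝ} (hα0 : 0 < α) (hα1 : α < 1) {C : Set (ℝ × ℝ)} {δ : ℝ}
    (hδ : 0 < δ) (hδ1 : δ ≤ 1) {f : ℝ × ℝ → ℝ} {ε : ℝ} (hε : 0 ≤ ε)
    (hf : ∀ q ∈ Metric.cthickening δ C, ContDiffAt ℝ ∞ f q ∧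
      ∀ k ≤ 3, ‖iteratedFDeriv ℝ k f q‖ ≤ ε) :
    c2HolderNorm α C f ≤ ENNReal.ofReal ((4 + 2 / δ ^ α) * ε) := by
  have hδα : 0 < δ ^ α := Real.rpow_pos_of_pos hδ α
  have hsub : C ⊆ Metric.cthickening δ C := Metric.self_subset_cthickening C
  have hk : ∀ k ≤ 3, ⨆ x ∈ C, ‖iteratedFDeriv ℝ k f x‖ₑ ≤ ENNReal.ofReal ε := fun k hk =>
    iSup₂_le fun x hx => by
      rw [← ofReal_norm]
      exact ENNReal.ofReal_le_ofReal ((hf x (hsub hx)).2 k hk)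
  have hH : (⨆ x ∈ C, ⨆ y ∈ C, ‖iteratedFDeriv ℝ 2 f x - iteratedFDeriv ℝ 2 f y‖ₑ / edist x y ^ α)
      ≤ ENNReal.ofReal ((1 + 2 / δ ^ α) * ε) := by
    refine iSup₂_le fun x hx => iSup₂_le fun y hy => ?_
    -- on the diagonal the quotient is `0 / 0 = 0`
    rcases eq_or_ne x y with rfl | hxy
    · rw [sub_self, ← ofReal_norm, norm_zero]
      simp
    have hd : 0 < dist x y := dist_pos.2 hxy
    rw [edist_dist, ENNReal.ofReal_rpow_of_pos hd, ← ofReal_norm,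
      ← ENNReal.ofReal_div_of_pos (Real.rpow_pos_of_pos hd α)]
    refine ENNReal.ofReal_le_ofReal ?_
    rw [div_le_iff₀ (Real.rpow_pos_of_pos hd α)]
    rcases le_total (dist x y) δ with hle | hle
    · have hball : ∀ p ∈ Metric.closedBall x δ, p ∈ Metric.cthickening δ C := fun p hp =>
        Metric.mem_cthickening_of_dist_le p x δ C hx hp
      have h1 := Convex.norm_image_sub_le_of_norm_fderiv_le (𝕜 := ℝ) (C := ε)
        (f := iteratedFDeriv ℝ 2 f) (s := Metric.closedBall x δ) (x := y) (y := x)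
        (fun p hp => (hf p (hball p hp)).1.differentiableAt_iteratedFDeriv
          (WithTop.coe_lt_coe.2 (ENat.natCast_lt_top 2)))
        (fun p hp => by
          rw [norm_fderiv_iteratedFDeriv]
          exact (hf p (hball p hp)).2 3 le_rfl)
        (convex_closedBall x δ) (by rwa [Metric.mem_closedBall, dist_comm])
        (Metric.mem_closedBall_self hδ.le)
      rw [← dist_eq_norm x y] at h1
      have h2 : dist x y ≤ dist x y ^ α := by
        conv_lhs => rw [← Real.rpow_one (dist x y)]
        exact Real.rpow_le_rpow_of_exponent_ge hd (hle.trans hδ1) hα1.le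
      have h3 : 0 ≤ 2 / δ ^ α * ε * dist x y ^ α := by positivity
      nlinarith [mul_le_mul_of_nonneg_left h2 hε]
    · have h1 : ‖iteratedFDeriv ℝ 2 f x - iteratedFDeriv ℝ 2 f y‖ ≤ 2 * ε := by
        refine (norm_sub_le _ _).trans ?_
        linarith [(hf x (hsub hx)).2 2 (by norm_num), (hf y (hsub hy)).2 2 (by norm_num)]
      have h2 : δ ^ α ≤ dist x y ^ α := Real.rpow_le_rpow hδ.le hle hα0.le
      have h3 : 2 * ε = 2 / δ ^ α * ε * δ ^ α := by field_simp
      have h4 := mul_le_mul_of_nonneg_left h2 (by positivity : 0 ≤ 2 / δ ^ α * ε)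
      have h5 : 0 ≤ ε * dist x y ^ α := by positivity
      linarith
  rw [c2HolderNorm]
  have e : ENNReal.ofReal ((4 + 2 / δ ^ α) * ε) = ENNReal.ofReal ε + ENNReal.ofReal ε +
      ENNReal.ofReal ε + ENNReal.ofReal ((1 + 2 / δ ^ α) * ε) := by
    rw [← ENNReal.ofReal_add hε hε, ← ENNReal.ofReal_add (by positivity) hε,
      ← ENNReal.ofReal_add (by positivity) (by positivity)]
    congr 1
    ring
  rw [e, Finset.sum_range_succ, Finset.sum_range_succ, Finset.sum_range_one]
  exact add_le_add (add_le_add (add_le_add (hk 0 (by norm_num)) (hk 1 (by norm_num)))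
    (hk 2 (by norm_num))) hH

theorem tendsto_c2HolderNorm_sheet {σ : ℝ} {ρ z : ℝ → ℝ → ℝ}
    (h : ∀ r > 0, IsProfile σ r (ρ r) (z r)) {α : ℝ} (hα0 : 0 < α) (hα1 : α < 1)
    {C : Set (ℝ × ℝ)} (hC : IsCompact C) (h0 : (0, 0) ∉ C) :
    Tendsto (fun r => c2HolderNorm α C (fun q => sheet (ρ r) (z r) q - 1)) (𝓝[>] 0) (𝓝 0) := by
  obtain ⟨δ₀, hδ₀, hsub₀⟩ := hC.exists_cthickening_subset_open
    (isOpen_compl_singleton (x := ((0, 0) : ℝ × ℝ))) (fun q hq e => h0 (e ▸ hq))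
  have hδ : 0 < min δ₀ 1 := lt_min hδ₀ one_pos
  have hA : IsCompact (Metric.cthickening (min δ₀ 1) C) := hC.cthickening
  have hA0 : ((0, 0) : ℝ × ℝ) ∉ Metric.cthickening (min δ₀ 1) C := fun hm =>
    hsub₀ (Metric.cthickening_mono (min_le_left _ _) C hm) rfl
  have hK : 0 < 4 + 2 / min δ₀ 1 ^ α := by
    have := Real.rpow_pos_of_pos hδ α
    positivity
  refine ENNReal.tendsto_nhds_zero.2 fun ε hε => ?_
  obtain ⟨η, hη, hηε⟩ : ∃ η : ℝ, 0 < η ∧ ENNReal.ofReal η ≤ ε := by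
    rcases eq_or_ne ε ⊤ with rfl | hne
    · exact ⟨1, one_pos, le_top⟩
    · exact ⟨ε.toReal, ENNReal.toReal_pos hε.ne' hne, ENNReal.ofReal_toReal_le⟩
  filter_upwards [eventually_sheet_small hA hA0 (div_pos hη hK), self_mem_nhdsWithin] with r hr hr0
  refine (c2HolderNorm_le hα0 hα1 hδ (min_le_right _ _) (div_pos hη hK).le fun q hq => ?_).trans ?_
  · obtain ⟨h1, h2⟩ := hr σ _ _ (h r hr0) q hq
    refine ⟨ContDiffAt.sub ?_ contDiffAt_const, h2⟩
    exact (h r hr0).contDiffOn_sheet.contDiffAt ((isOpen_openExterior r).mem_nhds h1)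
  · rwa [mul_div_cancel₀ _ hK.ne']

/-! ### The family of translators -/

theorem sheet_subsets {r : ℝ} {ρ z : ℝ → ℝ} (h : IsProfile 1 r ρ z) :
    vGraph (openExterior r) (sheet (fun t => ρ (-t)) (fun t => z (-t))) ⊆
        {p | 0 < p 2 ∧ p 2 < 1} ∧
      vGraph (openExterior r) (sheet ρ z) ⊆ {p | 1 < p 2} := by
  constructor
  · rintro p ⟨hp, hp2⟩
    have ht := h.reverse.timeOf_pos hp
    show 0 < p 2 ∧ p 2 < 1
    rw [hp2, ← h.z_zero]
    exact ⟨h.z_pos _, h.strictMono_z (neg_lt_zero.2 ht)⟩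
  · rintro p ⟨hp, hp2⟩
    have ht := h.timeOf_pos hp
    show 1 < p 2
    rw [hp2, ← h.z_zero]
    exact h.strictMono_z ht

theorem tendsto_heights {ρ z : ℝ → ℝ → ℝ} (h : ∀ r > 0, IsProfile 1 r (ρ r) (z r)) {l : Filter ℝ}
    {B : ℝ → ℝ} (hl : ∀ᶠ r in l, 0 < r) (hB : Tendsto B l (𝓝 0))
    (hle : ∀ r > 0, Real.exp (-B r) ≤ ⨅ t, z r t ∧ ⨆ t, z r t ≤ Real.exp (B r)) :
    Tendsto (fun r => ⨅ t, z r t) l (𝓝 1) ∧ Tendsto (fun r => ⨆ t, z r t) l (𝓝 1) := by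
  have h1 : Tendsto (fun r => Real.exp (-B r)) l (𝓝 1) := by
    simpa [Function.comp_def] using (Real.continuous_exp.tendsto _).comp hB.neg
  have h2 : Tendsto (fun r => Real.exp (B r)) l (𝓝 1) := by
    simpa [Function.comp_def] using (Real.continuous_exp.tendsto _).comp hB
  have hm : ∀ r > 0, ⨅ t, z r t < 1 := fun r hr => by
    simpa [(h r hr).z_zero] using (h r hr).iInf_lt_z 0
  have hp : ∀ r > 0, 1 < ⨆ t, z r t := fun r hr => by
    simpa [(h r hr).z_zero] using (h r hr).z_lt_iSup 0
  exact ⟨tendsto_of_tendsto_of_tendsto_of_le_of_le' h1 tendsto_const_nhds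
      (hl.mono fun r hr => (hle r hr).1) (hl.mono fun r hr => (hm r hr).le),
    tendsto_of_tendsto_of_tendsto_of_le_of_le' tendsto_const_nhds h2
      (hl.mono fun r hr => (hp r hr).le) (hl.mono fun r hr => (hle r hr).2)⟩

/-- If the heights of the surfaces converge to `1`, then in a compact set that avoids `(0, 0, 1)`
only points over a compact annulus remain. -/
theorem exists_compact_base {ρ z : ℝ → ℝ → ℝ} (h : ∀ r > 0, IsProfile 1 r (ρ r) (z r))
    (hm : Tendsto (fun r => ⨅ t, z r t) (𝓝[>] 0) (𝓝 1))
    (hp : Tendsto (fun r => ⨆ t, z r t) (𝓝[>] 0) (𝓝 1)) {K : Set E3} (hK : IsCompact K)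
    (hK0 : (![0, 0, 1] : E3) ∉ K) : ∃ C : Set (ℝ × ℝ), IsCompact C ∧ (0, 0) ∉ C ∧
      ∀ᶠ r in 𝓝[>] 0, profileSurface (ρ r) (z r) ∩ K ⊆
        vGraph C (sheet (fun t => ρ r (-t)) (fun t => z r (-t))) ∪
          vGraph C (sheet (ρ r) (z r)) := by
  obtain ⟨δ, hδ, hball⟩ := Metric.isOpen_iff.1 hK.isClosed.isOpen_compl _ hK0
  obtain ⟨B, hB⟩ := isBounded_iff_forall_norm_le.1 hK.isBounded
  refine ⟨Metric.closedBall 0 B ∩ {q | δ ^ 2 ≤ q.1 ^ 2 + q.2 ^ 2},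
    (isCompact_closedBall _ _).inter_right (isClosed_le continuous_const (by fun_prop)), ?_, ?_⟩
  · rintro ⟨-, h0⟩
    have : δ ^ 2 ≤ (0 : ℝ) ^ 2 + 0 ^ 2 := h0
    nlinarith
  · filter_upwards [hm.eventually_const_lt (show 1 - δ < 1 by linarith),
      hp.eventually_lt_const (show 1 < 1 + δ by linarith), self_mem_nhdsWithin] with r h1 h2 hr
    rintro p ⟨hpS, hpK⟩
    have hr := h r hr
    have hbase : (p 0, p 1) ∈ Metric.closedBall (0 : ℝ × ℝ) B ∩
        {q | δ ^ 2 ≤ q.1 ^ 2 + q.2 ^ 2} := by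
      constructor
      · rw [mem_closedBall_zero_iff, Prod.norm_def]
        exact max_le ((norm_le_pi_norm p 0).trans (hB p hpK))
          ((norm_le_pi_norm p 1).trans (hB p hpK))
      · by_contra hlt
        have hlt : p 0 ^ 2 + p 1 ^ 2 < δ ^ 2 := not_le.1 hlt
        refine (hball (?_ : p ∈ Metric.ball _ δ)) hpK
        obtain ⟨t, -, ht⟩ := hpS
        have h3 := hr.iInf_lt_z t
        have h4 := hr.z_lt_iSup t
        rw [Metric.mem_ball, dist_pi_lt_iff hδ]
        intro i
        rw [Real.dist_eq]
        fin_cases i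
        · simpa using abs_lt_of_sq_lt_sq (by nlinarith [sq_nonneg (p 1)] : p 0 ^ 2 < δ ^ 2) hδ.le
        · simpa using abs_lt_of_sq_lt_sq (by nlinarith [sq_nonneg (p 0)] : p 1 ^ 2 < δ ^ 2) hδ.le
        · have h5 : |p 2 - 1| < δ := by
            rw [abs_lt]
            constructor <;> linarith
          exact h5
    rw [hr.profileSurface_eq] at hpS
    exact hpS.imp (fun hp => ⟨hbase, hp.2⟩) (fun hp => ⟨hbase, hp.2⟩)

end HypTranslator

open HypTranslator
theorem mainTheorem2 :
    ∃ (S : ℝ → Set E3) (rm rp : ℝ → ℝ) (um up : ℝ → ℝ × ℝ → ℝ),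
      -- a family of pairwise noncongruent, properly embedded, rotational annular translators
      (∀ r > 0, ∀ r' > 0, r ≠ r' → ¬ HypCongruent (S r) (S r')) ∧
      (∀ r > 0, IsProperAnnularTranslator (S r) ∧ IsRotational (S r)) ∧
      -- each one lies in a slab between two horospheres; the asymptotic boundary
      (∀ r > 0, 0 < rm r ∧ rm r < 1 ∧ 1 < rp r ∧
        (∀ p ∈ S r, rm r < p 2 ∧ p 2 < rp r) ∧
        asymptoticBoundary (S r) = {OnePoint.infty} ∧
        asymptoticBoundary (S r) = asymptoticBoundary (horosphere 1)) ∧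
      -- it is the union of two vertical graphs over the complement of the `r`-disk
      (∀ r > 0, S r = vGraph (closedExterior r) (um r) ∪ vGraph (closedExterior r) (up r) ∧
        ContinuousOn (um r) (closedExterior r) ∧ ContinuousOn (up r) (closedExterior r) ∧
        ContDiffOn ℝ ∞ (um r) (openExterior r) ∧ ContDiffOn ℝ ∞ (up r) (openExterior r)) ∧
      -- the graphs lie below and above the horosphere `z = 1`, are bounded by the `r`-circle
      -- and asymptotic to the two bounding horospheres
      (∀ r > 0,
        vGraph (openExterior r) (um r) ⊆ {p | 0 < p 2 ∧ p 2 < 1} ∧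
        vGraph (openExterior r) (up r) ⊆ {p | 1 < p 2} ∧
        closure (vGraph (openExterior r) (um r)) \ vGraph (openExterior r) (um r)
          = neckCircle r ∧
        closure (vGraph (openExterior r) (up r)) \ vGraph (openExterior r) (up r)
          = neckCircle r ∧
        Tendsto (um r) (Bornology.cobounded (ℝ × ℝ)) (𝓝 (rm r)) ∧
        Tendsto (up r) (Bornology.cobounded (ℝ × ℝ)) (𝓝 (rp r))) ∧
      -- the heights of the horospheres converge to 1 at both ends of the family
      Tendsto rm (𝓝[>] 0) (𝓝 1) ∧ Tendsto rp (𝓝[>] 0) (𝓝 1) ∧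
      Tendsto rm atTop (𝓝 1) ∧ Tendsto rp atTop (𝓝 1) ∧
      -- as `r → 0`, `C^{2,α}` convergence of both sheets to the horosphere `z = 1` on compact
      -- sets that avoid `(0, 0, 1)`
      (∀ K : Set E3, IsCompact K → K ⊆ H3 → (![0, 0, 1] : E3) ∉ K →
        ∃ C : Set (ℝ × ℝ), IsCompact C ∧ (0, 0) ∉ C ∧
          ∀ᶠ r in 𝓝[>] 0, S r ∩ K ⊆ vGraph C (um r) ∪ vGraph C (up r)) ∧
      (∀ α : ℝ, 0 < α → α < 1 → ∀ C : Set (ℝ × ℝ), IsCompact C → (0, 0) ∉ C →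
        Tendsto (fun r => c2HolderNorm α C (fun q => um r q - 1)) (𝓝[>] 0) (𝓝 0) ∧
        Tendsto (fun r => c2HolderNorm α C (fun q => up r q - 1)) (𝓝[>] 0) (𝓝 0)) ∧
      -- as `r → ∞`, the surfaces leave every compact set
      (∀ K : Set E3, IsCompact K → K ⊆ H3 → ∀ᶠ r in atTop, S r ∩ K = ∅) := by
  -- the members with `r ≤ 0` play no role
  have hex : ∀ r : ℝ, ∃ ρ z : ℝ → ℝ, 0 < r → IsProfile 1 r ρ z := fun r => by
    by_cases hr : 0 < r
    · obtain ⟨ρ, z, h⟩ := exists_isProfile hr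
      exact ⟨ρ, z, fun _ => h⟩
    · exact ⟨0, 0, fun h => absurd h hr⟩
  choose ρ z h using hex
  have hzero := tendsto_heights h (l := 𝓝[>] 0) self_mem_nhdsWithin
    (B := fun r => 2 * √(2 * Real.exp 2 * r)) (by
      have : Continuous fun r : ℝ => 2 * √(2 * Real.exp 2 * r) := by fun_prop
      simpa using (this.tendsto 0).mono_left (nhdsWithin_le_nhds (s := Ioi 0)))
    fun r hr => (h r hr).heights_bound_sqrt
  have htop := tendsto_heights h (l := atTop) (eventually_gt_atTop 0)
    (B := fun r => 2 * (Real.exp 2 / r)) (by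
      simpa using ((tendsto_const_nhds (x := Real.exp 2)).div_atTop tendsto_id).const_mul 2)
    fun r hr => (h r hr).heights_bound_div
  refine ⟨fun r => profileSurface (ρ r) (z r), fun r => ⨅ t, z r t, fun r => ⨆ t, z r t,
    fun r => sheet (fun t => ρ r (-t)) (fun t => z r (-t)), fun r => sheet (ρ r) (z r),
    fun r hr r' hr' hne hcong => hne ?_, fun r hr => ⟨⟨_, (h r hr).isProperAnnulus,
      (h r hr).isTranslator⟩, profileSurface_isRotational _ _⟩, fun r hr => ⟨(h r hr).iInf_pos,
      ?_, ?_, ?_, (h r hr).hasNeck.asymptoticBoundary_eq, ?_⟩, fun r hr =>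
    ⟨(h r hr).profileSurface_eq, (h r hr).reverse.continuousOn_sheet,
      (h r hr).continuousOn_sheet, (h r hr).reverse.contDiffOn_sheet, (h r hr).contDiffOn_sheet⟩,
    fun r hr => ⟨(sheet_subsets (h r hr)).1, (sheet_subsets (h r hr)).2,
      closure_vGraph_diff hr (h r hr).reverse.continuousOn_sheet (h r hr).reverse.sheet_eq_one,
      closure_vGraph_diff hr (h r hr).continuousOn_sheet (h r hr).sheet_eq_one,
      (h r hr).reverse.tendsto_sheet ((h r hr).tendsto_z_atBot.comp tendsto_neg_atTop_atBot),
      (h r hr).tendsto_sheet (h r hr).tendsto_z_atTop⟩,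
    hzero.1, hzero.2, htop.1, htop.2,
    fun K hK _ hK0 => exists_compact_base h hzero.1 hzero.2 hK hK0,
    fun α hα0 hα1 C hC hC0 => ⟨tendsto_c2HolderNorm_sheet (fun r hr => (h r hr).reverse) hα0 hα1 hC
      hC0, tendsto_c2HolderNorm_sheet h hα0 hα1 hC hC0⟩, fun K hK _ => ?_⟩
  · exact radius_eq_of_hypCongruent (h r hr).hasNeck (h r' hr').hasNeck hcong
  · simpa [(h r hr).z_zero] using (h r hr).iInf_lt_z 0
  · simpa [(h r hr).z_zero] using (h r hr).z_lt_iSup 0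
  · rintro p ⟨t, -, hp⟩
    rw [hp]
    exact ⟨(h r hr).iInf_lt_z t, (h r hr).z_lt_iSup t⟩
  · rw [asymptoticBoundary_horosphere]
    exact (h r hr).hasNeck.asymptoticBoundary_eq
  · have hcont : Continuous fun p : E3 => p 0 ^ 2 + p 1 ^ 2 := by fun_prop
    obtain ⟨B, hB⟩ := (hK.image hcont).bddAbove
    filter_upwards [eventually_gt_atTop 0,
      (tendsto_pow_atTop (two_ne_zero)).eventually_gt_atTop B] with r hr hrB
    refine eq_empty_of_forall_notMem fun p hp => ?_
    have h1 := (h r hr).hasNeck.outside p hp.1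
    have h2 := hB (mem_image_of_mem _ hp.2)
    linarith
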